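/- Let $M\subset\mathbb{R}^d$ be a compact $d'$-dimensional embedded submanifold of class $\mathcal{C}^2$, $d'\le d$, possibly with a boundary $\partial M$, with the Riemannian metric inherited from $\mathbb{R}^d$, geodesic distance $\rho$ and Riemannian volume measure $\mathrm{vol}$. Let $X_1,X_2,\dots$ be i.i.d. random vectors with support $M$ and a density $f$ with respect to $\mathrm{vol}$ that is $\mathcal{C}^2$ on $M$. Let $h=h_n>0$ and $\beta_n$ satisfy $h_n\to0$, $\beta_n\to\infty$, $\beta_n h_n^2\to0$ and $nh_n^{d'}/(\beta_n^2\log n)\to\infty$, and let $$\hat f_n(x)=\frac{1}{n h_n^{d'}}\sum_{i=1}^n K\Big(\frac{\|x-X_i\|}{h_n}\Big),\qquad K(t)=\pi^{-d'/2}e^{-t^2}.$$ For $\lambda>0$ and a function $g$ on $M$ put $L_g=\{x\in M: g(x)\ge\lambda\}$, let $\partial L_g$ be its topological boundary in $M$, let $d_H$ be the Hausdorff distance between subsets of $M$ for the distance $\rho$, and let $d_\mu(A,B)=\mu(A\setminus B)+\mu(B\setminus A)$ for a measure $\mu$. Assume that every $x\in M$ with $f(x)=\lambda$ is a limit of points $a_n\in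 M$ with $f(a_n)>\lambda$ and of points $b_n\in M$ with $f(b_n)<\lambda$, that $\partial L_f\neq\emptyset$, and that $L_f\cap\partial M=\emptyset$. Then, with probability one, as $n\to\infty$, 1. $d_H(\partial L_{\hat f_n},\partial L_f)\to0$; 2. $d_H(L_{\hat f_n},L_f)\to0$; 3. if moreover the Riemannian gradient $\nabla_x f$ is nonzero at every $x\in M$ with $f(x)=\lambda$, then $d_\mu(L_{\hat f_n},L_f)\to0$ for every probability measure $\mu$ on $M$ that has a density with respect to $\mathrm{vol}$ (in particular for the law of $X_1$ and for the normalized volume). -/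

import Mathlib

open MeasureTheory ProbabilityTheory Filter Topology
open scoped ENNReal

noncomputable section

namespace LevelSets

/-- The model half-space of dimension `d'` inside `ℝ^d`: the coordinates of index `≥ d'` vanish,
and the first coordinate is nonnegative. -/
def modelHalfSpace (d d' : ℕ) : Set (EuclideanSpace ℝ (Fin d)) :=
  {y | (∀ i : Fin d, d' ≤ i.val → y i = 0) ∧ ∀ i : Fin d, i.val = 0 → 0 ≤ y i}

/-- The model subspace `ℝ^{d'} × {0}` of `ℝ^d`. -/
def modelSpace (d d' : ℕ) : Set (EuclideanSpace ℝ (Fin d)) :=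
  {y | ∀ i : Fin d, d' ≤ i.val → y i = 0}

/-- Some `C²` diffeomorphism between an open neighbourhood of `x` in `ℝ^d` and an open subset of
`ℝ^d` maps the part of `M` in that neighbourhood onto the part of `S` in the target. -/
def HasSliceChartAt {d : ℕ} (M S : Set (EuclideanSpace ℝ (Fin d)))
    (x : EuclideanSpace ℝ (Fin d)) : Prop :=
  ∃ Φ : OpenPartialHomeomorph (EuclideanSpace ℝ (Fin d)) (EuclideanSpace ℝ (Fin d)),
    x ∈ Φ.source ∧ ContDiffOn ℝ 2 Φ Φ.source ∧ ContDiffOn ℝ 2 Φ.symm Φ.target ∧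
      ∀ y ∈ Φ.source, y ∈ M ↔ Φ y ∈ S

/-- `M` is a `d'`-dimensional embedded submanifold of `ℝ^d` of class `C²`, possibly with
boundary. -/
def IsC2Submanifold {d : ℕ} (d' : ℕ) (M : Set (EuclideanSpace ℝ (Fin d))) : Prop :=
  d' ≤ d ∧ ∀ x ∈ M, HasSliceChartAt M (modelHalfSpace d d') x

/-- The boundary `∂M` of `M` as a manifold: the points of `M` near which `M` is not a
submanifold without boundary. -/
def manifoldBoundary {d : ℕ} (d' : ℕ) (M : Set (EuclideanSpace ℝ (Fin d))) :
    Set (EuclideanSpace ℝ (Fin d)) :=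
  {x | x ∈ M ∧ ¬ HasSliceChartAt M (modelSpace d d') x}

/-- The Riemannian volume measure of `M` (for the metric inherited from `ℝ^d`), as a measure on
`ℝ^d`: the `d'`-dimensional Hausdorff measure on `M`, normalized so that it is Lebesgue measure
on `d'`-dimensional Euclidean spaces. -/
def volumeMeasure {d : ℕ} (d' : ℕ) (M : Set (EuclideanSpace ℝ (Fin d))) :
    Measure (EuclideanSpace ℝ (Fin d)) :=
  (Measure.euclideanHausdorffMeasure d').restrict M

/-- The measure `B ↦ ∫_{B ∩ M} g dvol`. -/
def densityMeasure {d : ℕ} (d' : ℕ) (M : Set (EuclideanSpace ℝ (Fin d)))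
    (g : EuclideanSpace ℝ (Fin d) → ℝ) : Measure (EuclideanSpace ℝ (Fin d)) :=
  (volumeMeasure d' M).withDensity fun x => ENNReal.ofReal (g x)

/-- `g` is a probability density on `M` with respect to the volume measure. -/
structure IsDensity {d : ℕ} (d' : ℕ) (M : Set (EuclideanSpace ℝ (Fin d)))
    (g : EuclideanSpace ℝ (Fin d) → ℝ) : Prop where
  nonneg : ∀ x ∈ M, 0 ≤ g x
  aemeasurable : AEMeasurable g (volumeMeasure d' M)
  lintegral_eq_one : ∫⁻ x, ENNReal.ofReal (g x) ∂(volumeMeasure d' M) = 1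

/-- The geodesic distance `ρ(x, y)` on `M`: the infimum of the lengths of the `C¹` curves in `M`
from `x` to `y`. It is `∞` if there is none (different components). -/
def geodesicDist {d : ℕ} (M : Set (EuclideanSpace ℝ (Fin d)))
    (x y : EuclideanSpace ℝ (Fin d)) : ℝ≥0∞ :=
  ⨅ (γ : ℝ → EuclideanSpace ℝ (Fin d)) (_ : ContDiffOn ℝ 1 γ (Set.Icc 0 1))
    (_ : ∀ t ∈ Set.Icc (0 : ℝ) 1, γ t ∈ M) (_ : γ 0 = x) (_ : γ 1 = y),
    ∫⁻ t in Set.Icc (0 : ℝ) 1, ‖derivWithin γ (Set.Icc 0 1) t‖ₑ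

/-- The Hausdorff distance for the geodesic distance of `M`. It is `∞` if exactly one of the sets
is empty. -/
def hausdorffDistance {d : ℕ} (M A C : Set (EuclideanSpace ℝ (Fin d))) : ℝ≥0∞ :=
  max (⨆ a ∈ A, ⨅ c ∈ C, geodesicDist M a c) (⨆ c ∈ C, ⨅ a ∈ A, geodesicDist M c a)

/-- The distance in measure `μ(A \ B) + μ(B \ A)`. -/
def measureDistance {d : ℕ} (μ : Measure (EuclideanSpace ℝ (Fin d)))
    (A B : Set (EuclideanSpace ℝ (Fin d))) : ℝ≥0∞ :=
  μ (A \ B) + μ (B \ A)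

/-- The level set `{x ∈ M : g x ≥ l}`. -/
def levelSet {d : ℕ} (M : Set (EuclideanSpace ℝ (Fin d))) (g : EuclideanSpace ℝ (Fin d) → ℝ)
    (l : ℝ) : Set (EuclideanSpace ℝ (Fin d)) :=
  {x | x ∈ M ∧ l ≤ g x}

/-- The topological boundary of `A ⊆ M` in the space `M`. -/
def boundaryIn {d : ℕ} (M A : Set (EuclideanSpace ℝ (Fin d))) :
    Set (EuclideanSpace ℝ (Fin d)) :=
  Subtype.val '' frontier ((Subtype.val : M → EuclideanSpace ℝ (Fin d)) ⁻¹' A)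

/-- The tangent space of `M` at `x`, as a linear subspace of `ℝ^d`. -/
def tangentSpace {d : ℕ} (M : Set (EuclideanSpace ℝ (Fin d))) (x : EuclideanSpace ℝ (Fin d)) :
    Submodule ℝ (EuclideanSpace ℝ (Fin d)) :=
  Submodule.span ℝ (tangentConeAt ℝ M x)

/-- `v` is the Riemannian gradient at `x` of the restriction of `g` to `M`: it is tangent to `M`
and `g y = g x + ⟪v, y - x⟫ + o(‖y - x‖)` as `y → x` in `M`. -/
def IsRiemannianGradient {d : ℕ} (M : Set (EuclideanSpace ℝ (Fin d)))
    (g : EuclideanSpace ℝ (Fin d) → ℝ) (x v : EuclideanSpace ℝ (Fin d)) : Prop :=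
  v ∈ tangentSpace M x ∧ HasGradientWithinAt g v M x

/-- The Gaussian kernel `K(t) = π^{-d'/2} exp(-t²)`. -/
def gaussKernel (d' : ℕ) (t : ℝ) : ℝ :=
  Real.pi ^ (-(d' : ℝ) / 2) * Real.exp (-t ^ 2)

/-- The kernel density estimator `(1 / (n h^{d'})) ∑_{i < n} K(‖x - X_i‖ / h)` built on the first
`n` points of the sequence `X`. -/
def kde {d : ℕ} (d' : ℕ) (h : ℝ) (n : ℕ) (X : ℕ → EuclideanSpace ℝ (Fin d))
    (x : EuclideanSpace ℝ (Fin d)) : ℝ :=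
  1 / (n * h ^ d') * ∑ i ∈ Finset.range n, gaussKernel d' (‖x - X i‖ / h)

end LevelSets

end

noncomputable section

namespace LevelSets

open Metric Set

/-! Randomness enters only once: almost surely the estimator is uniformly close on `M` to its mean
`meanKernel / h ^ d'` (`ae_eventually_abs_kde_sub_le`). A summand has values in [0, 1] and mean
O(h^d'), so a Chernoff bound has an exponent of order n h^d', which beats any multiple of log n. A
net of `M` with polynomially many points, Lipschitz bounds and Borel–Cantelli make this uniform.

The mean integrates against f a Gaussian concentrated at scale h. In a chart that is bi-Lipschitz
with constants 1 ± ε (`IsLocalParametrization`) it becomes, up to powers of 1 ± ε, a Gaussian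
integral over ℝ^d'. Off ∂M the rescaled mean therefore tends to f, locally uniformly. At a point of
∂M part of the Gaussian mass is missing and only the upper bound is kept. This one-sided mode of
convergence is `TendstoAtInterior`. It is enough: L_f misses ∂M, so f < l on ∂M, where an upper
bound suffices to keep the estimator below l.

The three conclusions then follow by compactness of `M`. Near a point with f ≠ l the estimator is
eventually on the same side of l as f. Around a point with f = l, a connected neighbourhood of small
geodesic diameter contains one fixed point with f > l and one with f < l. The estimator eventually
separates them in the same way, so its level set has a boundary point in that neighbourhood. For the
distance in measure, the symmetric difference lies in a shell |f - l| < δ, whose measure tends to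
that of {f = l} as δ → 0; this set is null because f has a nonzero derivative along it in charts. -/

/-! ### Local parametrizations and the geodesic distance -/

/-- The model subspace as a linear subspace. -/
def modelSubmodule (d d' : ℕ) : Submodule ℝ (EuclideanSpace ℝ (Fin d)) where
  carrier := modelSpace d d'
  add_mem' := by
    intro a b ha hb i hi
    simp [ha i hi, hb i hi]
  zero_mem' := by
    intro i _
    simp
  smul_mem' := by
    intro c a ha i hi
    simp [ha i hi]

theorem mem_modelSubmodule {d d' : ℕ} {y : EuclideanSpace ℝ (Fin d)} :
    y ∈ modelSubmodule d d' ↔ y ∈ modelSpace d d' := Iff.rfl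

theorem finrank_modelSubmodule {d d' : ℕ} (hd : d' ≤ d) :
    Module.finrank ℝ (modelSubmodule d d') = d' := by
  let e : modelSubmodule d d' ≃ₗ[ℝ] (Fin d' → ℝ) :=
    { toFun := fun y i => y.1 (Fin.castLE hd i)
      map_add' := by intro x y; ext i; simp
      map_smul' := by intro c y; ext i; simp
      invFun := fun u => ⟨WithLp.toLp 2 fun i => if hi : i.val < d' then u ⟨i.val, hi⟩ else 0, by
        intro i hi
        simp [hi]⟩
      left_inv := by
        intro y
        ext i
        by_cases hi : i.val < d'
        · simp [hi]
        · simp [hi, y.2 i (not_lt.1 hi)]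
      right_inv := by
        intro u
        ext i
        simp }
  rw [e.finrank_eq]
  simp

/-- A subspace of dimension `k` can be parametrized in such a way that a given injective linear map
becomes isometric on it. -/
theorem exists_linear_parametrization {E F : Type*} [NormedAddCommGroup E] [InnerProductSpace ℝ E]
    [FiniteDimensional ℝ E] [NormedAddCommGroup F] [InnerProductSpace ℝ F] {k : ℕ}
    (W : Submodule ℝ E)
    (hW : Module.finrank ℝ W = k) (A : E →L[ℝ] F) (hA : Function.Injective A) :
    ∃ j : EuclideanSpace ℝ (Fin k) →L[ℝ] E, LinearMap.range j.toLinearMap = W ∧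
      ∀ w, ‖A (j w)‖ = ‖w‖ := by
  let B : W →ₗ[ℝ] F := A.toLinearMap ∘ₗ W.subtype
  have hB : Function.Injective B := hA.comp W.injective_subtype
  let e := LinearEquiv.ofInjective B hB
  have hk : Module.finrank ℝ (LinearMap.range B) = k := by rw [← e.finrank_eq, hW]
  subst hk
  let J := (stdOrthonormalBasis ℝ (LinearMap.range B)).repr.symm
  let j : EuclideanSpace ℝ (Fin (Module.finrank ℝ (LinearMap.range B))) →ₗ[ℝ] E :=
    W.subtype ∘ₗ (e.symm.toLinearMap ∘ₗ J.toLinearEquiv.toLinearMap)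
  refine ⟨LinearMap.toContinuousLinearMap j, ?_, ?_⟩
  · ext y
    simp only [LinearMap.mem_range]
    constructor
    · rintro ⟨w, rfl⟩
      exact (e.symm (J w)).2
    · intro hy
      refine ⟨J.symm (e ⟨y, hy⟩), ?_⟩
      simp [j]
  · intro w
    have h1 : A (j w) = B (e.symm (J w)) := rfl
    have h2 : B (e.symm (J w)) = (e (e.symm (J w)) : F) := rfl
    have : ‖A (j w)‖ = ‖w‖ := by
      rw [h1, h2, LinearEquiv.apply_symm_apply]
      exact J.norm_map w
    exact this

/-- `ψ`, on the ball of radius `r` at the origin of `ℝ^{d'}`, is a bi-Lipschitz map with constants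
`1 ± ε`; it parametrizes a neighbourhood of `p` in `M` by the points of the closed convex set `H`
in the ball. -/
structure IsLocalParametrization {d d' : ℕ} (M : Set (EuclideanSpace ℝ (Fin d)))
    (p : EuclideanSpace ℝ (Fin d)) (ε : ℝ)
    (ψ : EuclideanSpace ℝ (Fin d') → EuclideanSpace ℝ (Fin d)) (r : ℝ)
    (H : Set (EuclideanSpace ℝ (Fin d'))) : Prop where
  radius_pos : 0 < r
  map_zero : ψ 0 = p
  zero_mem : 0 ∈ H
  convex : Convex ℝ H
  isClosed : IsClosed H
  contDiffOn : ContDiffOn ℝ 1 ψ (ball 0 r)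
  map_mem : ∀ u ∈ ball 0 r ∩ H, ψ u ∈ M
  surj : ∀ᶠ x in 𝓝[M] p, ∃ u ∈ ball 0 r ∩ H, ψ u = x
  lower : ∀ u ∈ ball 0 r, ∀ v ∈ ball 0 r, (1 - ε) * ‖u - v‖ ≤ ‖ψ u - ψ v‖
  upper : ∀ u ∈ ball 0 r, ∀ v ∈ ball 0 r, ‖ψ u - ψ v‖ ≤ (1 + ε) * ‖u - v‖

theorem modelHalfSpace_subset {d d' : ℕ} : modelHalfSpace d d' ⊆ modelSpace d d' := fun _ h => h.1

theorem convex_modelHalfSpace {d d' : ℕ} : Convex ℝ (modelHalfSpace d d') := by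
  intro x hx y hy a b ha hb _
  refine ⟨fun i hi => by simp [hx.1 i hi, hy.1 i hi], fun i hi => ?_⟩
  have h1 := hx.2 i hi
  have h2 := hy.2 i hi
  simp only [PiLp.add_apply, PiLp.smul_apply, smul_eq_mul]
  positivity

theorem isClosed_modelHalfSpace {d d' : ℕ} : IsClosed (modelHalfSpace d d') := by
  simp only [modelHalfSpace, ofPred_and, ofPred_forall]
  refine IsClosed.inter ?_ ?_
  · refine isClosed_iInter fun i => isClosed_iInter fun _ => ?_
    exact isClosed_eq (by fun_prop) continuous_const
  · refine isClosed_iInter fun i => isClosed_iInter fun _ => ?_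
    exact isClosed_le continuous_const (by fun_prop)

/-- Precomposing the inverse chart with a suitable linear map makes its derivative at 0 an isometric
embedding; strict differentiability then bounds the deviation from this embedding by ε‖u - v‖ on a
small ball. Keeping `S` general serves both the half-space, available at every point of `M`, and the
full model space, available off ∂M, where `H` is everything. -/
theorem exists_localParametrization_of_slice {d d' : ℕ} (hd : d' ≤ d)
    {M S : Set (EuclideanSpace ℝ (Fin d))} (hS : S ⊆ modelSpace d d') (hSc : Convex ℝ S)
    (hScl : IsClosed S) {p : EuclideanSpace ℝ (Fin d)} (hp : p ∈ M) (hchart : HasSliceChartAt M S p)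
    {ε : ℝ} (hε : 0 < ε) {N : Set (EuclideanSpace ℝ (Fin d))} (hN : N ∈ 𝓝 p) :
    ∃ (ψ : EuclideanSpace ℝ (Fin d') → EuclideanSpace ℝ (Fin d)) (r : ℝ)
      (H : Set (EuclideanSpace ℝ (Fin d'))), IsLocalParametrization M p ε ψ r H ∧
      (∀ u ∈ ball 0 r, ψ u ∈ N) ∧ (S = modelSpace d d' → H = univ) := by
  obtain ⟨Φ, hps, hΦ, hΦs, hM⟩ := hchart
  have hpt : Φ p ∈ Φ.target := Φ.map_source hps
  have hΦsp : ContDiffAt ℝ 2 Φ.symm (Φ p) := hΦs.contDiffAt (Φ.open_target.mem_nhds hpt)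
  have hΦp : ContDiffAt ℝ 2 Φ p := hΦ.contDiffAt (Φ.open_source.mem_nhds hps)
  set A := fderiv ℝ Φ.symm (Φ p) with hAdef
  have hA1 : HasStrictFDerivAt Φ.symm A (Φ p) := hΦsp.hasStrictFDerivAt (by norm_num)
  have hB1 : HasFDerivAt Φ (fderiv ℝ Φ p) (Φ.symm (Φ p)) := by
    rw [Φ.left_inv hps]
    exact (hΦp.differentiableAt (by norm_num)).hasFDerivAt
  have hBA : (fderiv ℝ Φ p).comp A = ContinuousLinearMap.id ℝ _ := by
    have h1 := hB1.comp (Φ p) hA1.hasFDerivAt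
    have h2 : HasFDerivAt (Φ ∘ Φ.symm) (ContinuousLinearMap.id ℝ _) (Φ p) := by
      refine (hasFDerivAt_id (Φ p)).congr_of_eventuallyEq ?_
      filter_upwards [Φ.open_target.mem_nhds hpt] with y hy
      simp [Φ.right_inv hy]
    exact h1.unique h2
  have hAinj : Function.Injective A := by
    intro x y hxy
    have := congrArg (fderiv ℝ Φ p) hxy
    have hx := DFunLike.congr_fun hBA x
    have hy := DFunLike.congr_fun hBA y
    simp only [ContinuousLinearMap.comp_apply, ContinuousLinearMap.id_apply] at hx hy
    rw [← hx, ← hy, this]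
  obtain ⟨j, hjr, hj⟩ := exists_linear_parametrization (modelSubmodule d d')
    (finrank_modelSubmodule hd) A hAinj
  have hjmem : ∀ w, j w ∈ modelSubmodule d d' := by
    intro w
    rw [← hjr]
    exact ⟨w, rfl⟩
  have hpS : Φ p ∈ S := (hM p hps).1 hp
  set g : EuclideanSpace ℝ (Fin d') → EuclideanSpace ℝ (Fin d) := fun w => Φ p + j w with hg
  have hg0 : g 0 = Φ p := by simp [hg]
  have hgc : Continuous g := by fun_prop
  have hgs : HasStrictFDerivAt g j 0 := by
    exact (j.hasStrictFDerivAt).const_add _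
  set ψ := fun w => Φ.symm (g w) with hψ
  have hψs : HasStrictFDerivAt ψ (A.comp j) 0 := by
    have : HasStrictFDerivAt Φ.symm A (g 0) := by rw [hg0]; exact hA1
    exact this.comp 0 hgs
  obtain ⟨s, hs, happ⟩ := hψs.approximates_deriv_on_nhds
    (c := ⟨ε, hε.le⟩) (Or.inr (by exact_mod_cast hε))
  have hψ0 : ψ 0 = p := by simp [hψ, hg0, Φ.left_inv hps]
  have hgt : g ⁻¹' Φ.target ∈ 𝓝 (0 : EuclideanSpace ℝ (Fin d')) := by
    apply hgc.continuousAt.preimage_mem_nhds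
    rw [hg0]
    exact Φ.open_target.mem_nhds hpt
  have hNn : ψ ⁻¹' N ∈ 𝓝 (0 : EuclideanSpace ℝ (Fin d')) := by
    apply hψs.continuousAt.preimage_mem_nhds
    rwa [hψ0]
  obtain ⟨r, hr, hball⟩ := Metric.mem_nhds_iff.1 (inter_mem hs (inter_mem hgt hNn))
  have hest : ∀ u ∈ ball (0 : EuclideanSpace ℝ (Fin d')) r, ∀ v ∈ ball 0 r,
      ‖ψ u - ψ v - A (j (u - v))‖ ≤ ε * ‖u - v‖ := fun u hu v hv =>
    happ _ (hball hu).1 _ (hball hv).1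
  refine ⟨ψ, r, g ⁻¹' S, ⟨hr, hψ0, ?_, ?_, hScl.preimage hgc, ?_, ?_, ?_, ?_, ?_⟩, ?_, ?_⟩
  · change g 0 ∈ S
    rwa [hg0]
  · intro x hx y hy a b ha hb hab
    have : g (a • x + b • y) = a • g x + b • g y := by
      have h1 : Φ p = a • Φ p + b • Φ p := by rw [← add_smul, hab, one_smul]
      simp only [hg, map_add, map_smul, smul_add]
      nth_rewrite 1 [h1]
      abel
    change g _ ∈ S
    rw [this]
    exact hSc hx hy ha hb hab
  · refine ContDiffOn.comp (t := Φ.target) (hΦs.of_le (by norm_num)) ?_ ?_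
    · exact (contDiff_const.add j.contDiff).contDiffOn
    · intro u hu
      exact (hball hu).2.1
  · rintro u ⟨hu, huS⟩
    have ht : g u ∈ Φ.target := (hball hu).2.1
    rw [hM _ (Φ.map_target ht), Φ.right_inv ht]
    exact huS
  -- A small vector of the model space has a small preimage under `j`, since ‖u‖ = ‖A (j u)‖ ≤ ‖A‖
  -- ‖j u‖. The 1 added to ‖A‖ avoids a division by zero.
  · have hqc : ∀ q : EuclideanSpace ℝ (Fin d), q ∈ modelSubmodule d d' → ‖q‖ < r / (‖A‖ + 1) →
        ∃ u ∈ ball (0 : EuclideanSpace ℝ (Fin d')) r, j u = q := by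
      intro q hq hqr
      rw [← hjr] at hq
      obtain ⟨u, rfl⟩ := hq
      refine ⟨u, ?_, rfl⟩
      rw [mem_ball_zero_iff, ← hj u]
      have hqr' : ‖j u‖ < r / (‖A‖ + 1) := hqr
      rw [lt_div_iff₀ (by positivity)] at hqr'
      calc ‖A (j u)‖ ≤ ‖A‖ * ‖j u‖ := A.le_opNorm _
        _ ≤ ‖j u‖ * (‖A‖ + 1) := by nlinarith [norm_nonneg (j u)]
        _ < r := hqr'
    have hcont : ContinuousAt Φ p := Φ.continuousAt hps
    have hnear : ∀ᶠ x in 𝓝 p, ‖Φ x - Φ p‖ < r / (‖A‖ + 1) := by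
      have : Tendsto (fun x => ‖Φ x - Φ p‖) (𝓝 p) (𝓝 0) := by
        have := (hcont.sub_const (Φ p)).norm
        simpa [ContinuousAt] using this
      exact this.eventually_lt_const (by positivity)
    filter_upwards [self_mem_nhdsWithin, mem_nhdsWithin_of_mem_nhds hnear,
      mem_nhdsWithin_of_mem_nhds (Φ.open_source.mem_nhds hps)] with x hxM hx hxs
    have hxS : Φ x ∈ S := (hM x hxs).1 hxM
    obtain ⟨u, hu, hju⟩ := hqc (Φ x - Φ p)
      (Submodule.sub_mem _ (mem_modelSubmodule.2 (hS hxS)) (mem_modelSubmodule.2 (hS hpS))) hx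
    have hgu : g u = Φ x := by simp [hg, hju]
    refine ⟨u, ⟨hu, ?_⟩, ?_⟩
    · change g u ∈ S
      rwa [hgu]
    · simp [hψ, hgu, Φ.left_inv hxs]
  · intro u hu v hv
    have h1 := hest u hu v hv
    have h2 : ‖A (j (u - v))‖ = ‖u - v‖ := hj _
    have h3 := norm_sub_norm_le (A (j (u - v))) (ψ u - ψ v)
    rw [norm_sub_rev (A (j (u - v)))] at h3
    linarith
  · intro u hu v hv
    have h1 := hest u hu v hv
    have h2 : ‖A (j (u - v))‖ = ‖u - v‖ := hj _
    have h3 := norm_sub_norm_le (ψ u - ψ v) (A (j (u - v)))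
    linarith
  · intro u hu
    exact (hball hu).2.2
  · intro hSeq
    ext u
    simp only [mem_preimage, mem_univ, iff_true, hSeq]
    exact Submodule.add_mem (modelSubmodule d d') (mem_modelSubmodule.2 (hS hpS)) (hjmem u)

theorem IsC2Submanifold.exists_localParametrization {d d' : ℕ}
    {M : Set (EuclideanSpace ℝ (Fin d))} (hM : IsC2Submanifold d' M)
    {p : EuclideanSpace ℝ (Fin d)} (hp : p ∈ M) {ε : ℝ} (hε : 0 < ε)
    {N : Set (EuclideanSpace ℝ (Fin d))} (hN : N ∈ 𝓝 p) :
    ∃ (ψ : EuclideanSpace ℝ (Fin d') → EuclideanSpace ℝ (Fin d)) (r : ℝ)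
      (H : Set (EuclideanSpace ℝ (Fin d'))), IsLocalParametrization M p ε ψ r H ∧
      ∀ u ∈ ball 0 r, ψ u ∈ N := by
  obtain ⟨ψ, r, H, h1, h2, -⟩ := exists_localParametrization_of_slice hM.1 modelHalfSpace_subset
    convex_modelHalfSpace isClosed_modelHalfSpace hp (hM.2 p hp) hε hN
  exact ⟨ψ, r, H, h1, h2⟩

theorem IsC2Submanifold.exists_localParametrization_univ {d d' : ℕ}
    {M : Set (EuclideanSpace ℝ (Fin d))} (hM : IsC2Submanifold d' M)
    {p : EuclideanSpace ℝ (Fin d)} (hp : p ∈ M) (hpb : p ∉ manifoldBoundary d' M)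
    {ε : ℝ} (hε : 0 < ε) {N : Set (EuclideanSpace ℝ (Fin d))} (hN : N ∈ 𝓝 p) :
    ∃ (ψ : EuclideanSpace ℝ (Fin d') → EuclideanSpace ℝ (Fin d)) (r : ℝ),
      IsLocalParametrization M p ε ψ r univ ∧ ∀ u ∈ ball 0 r, ψ u ∈ N := by
  have hchart : HasSliceChartAt M (modelSpace d d') p := by
    by_contra h
    exact hpb ⟨hp, h⟩
  obtain ⟨ψ, r, H, h1, h2, h3⟩ := exists_localParametrization_of_slice hM.1 subset_rfl
    (modelSubmodule d d').convex (modelSubmodule d d').closed_of_finiteDimensional hp hchart hε hN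
  rw [h3 rfl] at h1
  exact ⟨ψ, r, h1, h2⟩

namespace IsLocalParametrization

variable {d d' : ℕ} {M : Set (EuclideanSpace ℝ (Fin d))} {p : EuclideanSpace ℝ (Fin d)} {ε : ℝ}
  {ψ : EuclideanSpace ℝ (Fin d') → EuclideanSpace ℝ (Fin d)} {r : ℝ}
  {H : Set (EuclideanSpace ℝ (Fin d'))}

theorem lipschitzOnWith (hψ : IsLocalParametrization M p ε ψ r H) (hε : 0 ≤ ε) :
    LipschitzOnWith (Real.toNNReal (1 + ε)) ψ (ball 0 r) := by
  refine LipschitzOnWith.of_dist_le_mul fun u hu v hv => ?_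
  rw [dist_eq_norm, dist_eq_norm, Real.coe_toNNReal _ (by linarith)]
  exact hψ.upper u hu v hv

theorem injOn (hψ : IsLocalParametrization M p ε ψ r H) (hε : ε < 1) : InjOn ψ (ball 0 r) := by
  intro u hu v hv huv
  have := hψ.lower u hu v hv
  rw [huv, sub_self, norm_zero] at this
  have h0 : ‖u - v‖ ≤ 0 := by
    by_contra! h
    nlinarith
  exact sub_eq_zero.1 (norm_le_zero_iff.1 h0)

theorem continuousOn (hψ : IsLocalParametrization M p ε ψ r H) : ContinuousOn ψ (ball 0 r) :=
  hψ.contDiffOn.continuousOn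

theorem eventually_exists_mem_ball (hψ : IsLocalParametrization M p ε ψ r H) (hε : ε < 1) {δ : ℝ}
    (hδ : 0 < δ) : ∀ᶠ x in 𝓝[M] p, ∃ u ∈ ball 0 r ∩ H, ψ u = x ∧ ‖u‖ < δ := by
  have hnear : ∀ᶠ x in 𝓝[M] p, dist x p < (1 - ε) * δ :=
    mem_nhdsWithin_of_mem_nhds (ball_mem_nhds p (mul_pos (by linarith) hδ))
  filter_upwards [hψ.surj, hnear] with x ⟨u, hu, hux⟩ hx
  refine ⟨u, hu, hux, ?_⟩
  have := hψ.lower u hu.1 0 (mem_ball_self hψ.radius_pos)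
  rw [hψ.map_zero, hux, sub_zero, ← dist_eq_norm] at this
  have h1 : 0 < 1 - ε := by linarith
  exact lt_of_mul_lt_mul_left (this.trans_lt hx) h1.le

/-- The image of the straight segment from u to v stays in `M` because `H` is convex, and its speed
is at most the Lipschitz constant times ‖u - v‖. -/
theorem geodesicDist_le (hψ : IsLocalParametrization M p ε ψ r H) (hε : 0 ≤ ε)
    {u v : EuclideanSpace ℝ (Fin d')} (hu : u ∈ ball 0 r ∩ H) (hv : v ∈ ball 0 r ∩ H) :
    geodesicDist M (ψ u) (ψ v) ≤ ENNReal.ofReal ((1 + ε) * ‖u - v‖) := by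
  have hconv : Convex ℝ (ball 0 r ∩ H) := (convex_ball _ _).inter hψ.convex
  set c : ℝ → EuclideanSpace ℝ (Fin d') := fun t => u + t • (v - u) with hc
  have hcm : ∀ t ∈ Icc (0 : ℝ) 1, c t ∈ ball 0 r ∩ H := fun t ht =>
    hconv.add_smul_sub_mem hu hv ht
  have hcd : ∀ t, HasDerivAt c (v - u) t := fun t => by
    simpa [hc] using ((hasDerivAt_id t).smul_const (v - u)).const_add u
  refine iInf_le_of_le (fun t => ψ (c t)) (iInf_le_of_le ?_ (iInf_le_of_le ?_
    (iInf_le_of_le ?_ (iInf_le_of_le ?_ ?_))))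
  · refine hψ.contDiffOn.comp (ContDiff.contDiffOn ?_) fun t ht => (hcm t ht).1
    fun_prop
  · exact fun t ht => hψ.map_mem _ (hcm t ht)
  · simp [hc]
  · simp [hc]
  · calc ∫⁻ t in Icc (0 : ℝ) 1, ‖derivWithin (fun t => ψ (c t)) (Icc 0 1) t‖ₑ
        ≤ ∫⁻ t in Icc (0 : ℝ) 1, ENNReal.ofReal ((1 + ε) * ‖u - v‖) := by
          refine setLIntegral_mono measurable_const fun t ht => ?_
          have hb : ball 0 r ∈ 𝓝 (c t) := isOpen_ball.mem_nhds (hcm t ht).1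
          have hd : DifferentiableAt ℝ ψ (c t) :=
            (hψ.contDiffOn.differentiableOn (by norm_num)).differentiableAt hb
          have h1 := (hd.hasFDerivAt.comp_hasDerivAt t (hcd t)).hasDerivWithinAt (s := Icc 0 1)
          have h2 : derivWithin (fun t => ψ (c t)) (Icc 0 1) t = fderiv ℝ ψ (c t) (v - u) :=
            h1.derivWithin (uniqueDiffOn_Icc zero_lt_one t ht)
          rw [h2, ← ofReal_norm]
          apply ENNReal.ofReal_le_ofReal
          have h3 := norm_fderiv_le_of_lipschitzOn ℝ hb (hψ.lipschitzOnWith hε)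
          rw [Real.coe_toNNReal _ (by linarith)] at h3
          rw [norm_sub_rev u v]
          exact (ContinuousLinearMap.le_opNorm _ _).trans (by gcongr)
      _ = ENNReal.ofReal ((1 + ε) * ‖u - v‖) := by simp

end IsLocalParametrization

/-- Small connected neighbourhoods for the geodesic distance. -/
theorem IsC2Submanifold.exists_preconnected_nhds {d d' : ℕ}
    {M : Set (EuclideanSpace ℝ (Fin d))} (hM : IsC2Submanifold d' M)
    {p : EuclideanSpace ℝ (Fin d)} (hp : p ∈ M) {η : ℝ} (hη : 0 < η) :
    ∃ Q ∈ 𝓝[M] p, Q ⊆ M ∧ IsPreconnected Q ∧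
      ∀ x ∈ Q, ∀ y ∈ Q, geodesicDist M x y ≤ ENNReal.ofReal η := by
  obtain ⟨ψ, r, H, hψ, -⟩ := hM.exists_localParametrization hp (ε := 1 / 2) (by norm_num)
    (univ_mem (f := 𝓝 p))
  -- Two points of the ball of radius δ are less than 2δ apart, and the chart stretches by at most
  -- 3/2: hence η / 3.
  set δ := min r (η / 3) with hδ
  have hδ0 : 0 < δ := lt_min hψ.radius_pos (by linarith)
  have hsub : ball (0 : EuclideanSpace ℝ (Fin d')) δ ∩ H ⊆ ball 0 r ∩ H :=
    inter_subset_inter_left _ (ball_subset_ball (min_le_left _ _))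
  refine ⟨ψ '' (ball 0 δ ∩ H), ?_, ?_, ?_, ?_⟩
  · filter_upwards [hψ.eventually_exists_mem_ball (by norm_num) hδ0] with x ⟨u, hu, hux, hud⟩
    exact ⟨u, ⟨mem_ball_zero_iff.2 hud, hu.2⟩, hux⟩
  · rintro _ ⟨u, hu, rfl⟩
    exact hψ.map_mem u (hsub hu)
  · refine (((convex_ball _ _).inter hψ.convex).isPreconnected).image _
      (hψ.continuousOn.mono fun u hu => (hsub hu).1)
  · rintro _ ⟨u, hu, rfl⟩ _ ⟨v, hv, rfl⟩
    refine (hψ.geodesicDist_le (by norm_num) (hsub hu) (hsub hv)).trans ?_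
    apply ENNReal.ofReal_le_ofReal
    have h1 := mem_ball_zero_iff.1 hu.1
    have h2 := mem_ball_zero_iff.1 hv.1
    have h3 : ‖u - v‖ ≤ ‖u‖ + ‖v‖ := norm_sub_le _ _
    have h4 : δ ≤ η / 3 := min_le_right _ _
    linarith

/-! ### Gaussian integrals, and the volume measure in charts -/

theorem euclideanHausdorffMeasure_image_le {X Y : Type*} [EMetricSpace X] [MeasurableSpace X]
    [BorelSpace X] [EMetricSpace Y] [MeasurableSpace Y] [BorelSpace Y] {K : NNReal} {f : X → Y}
    {s : Set X} (hf : LipschitzOnWith K f s) (k : ℕ) :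
    Measure.euclideanHausdorffMeasure k (f '' s) ≤
      (K : ℝ≥0∞) ^ k * Measure.euclideanHausdorffMeasure k s := by
  have h := hf.hausdorffMeasure_image_le (d := (k : ℝ)) (by positivity)
  rw [ENNReal.rpow_natCast] at h
  simp only [Measure.euclideanHausdorffMeasure_def, Measure.smul_apply, ENNReal.smul_def,
    smul_eq_mul]
  calc _ ≤ _ * ((K : ℝ≥0∞) ^ k * Measure.hausdorffMeasure (k : ℝ) s) := by gcongr
    _ = _ := by ring

theorem gaussKernel_nonneg (k : ℕ) (t : ℝ) : 0 ≤ gaussKernel k t := by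
  unfold gaussKernel
  positivity

theorem gaussKernel_anti (k : ℕ) {s t : ℝ} (hs : 0 ≤ s) (hst : s ≤ t) :
    gaussKernel k t ≤ gaussKernel k s := by
  unfold gaussKernel
  have : s ^ 2 ≤ t ^ 2 := by gcongr
  gcongr

theorem continuous_gaussKernel (k : ℕ) : Continuous (gaussKernel k) := by
  unfold gaussKernel
  fun_prop

theorem gaussKernel_le_one (k : ℕ) (t : ℝ) : gaussKernel k t ≤ 1 := by
  unfold gaussKernel
  have h1 : Real.pi ^ (-(k : ℝ) / 2) ≤ 1 := by
    apply Real.rpow_le_one_of_one_le_of_nonpos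
    · linarith [Real.pi_gt_three]
    · have : (0 : ℝ) ≤ k := by positivity
      linarith
  have h2 : Real.exp (-t ^ 2) ≤ 1 := Real.exp_le_one_iff.2 (by nlinarith [sq_nonneg t])
  have h3 := Real.exp_nonneg (-t ^ 2)
  nlinarith

/-- The factor π^(-k/2) gives the kernel total mass 1 on ℝ^k, and the rest is scaling. The factor
`a` leaves room for the distortion 1 ± ε of a chart. -/
theorem lintegral_gaussKernel (k : ℕ) {a h : ℝ} (ha : 0 < a) (hh : 0 < h)
    (u : EuclideanSpace ℝ (Fin k)) :
    ∫⁻ v : EuclideanSpace ℝ (Fin k), ENNReal.ofReal (gaussKernel k (a * ‖u - v‖ / h)) =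
      ENNReal.ofReal ((h / a) ^ k) := by
  have hb : 0 < (a / h) ^ 2 := by positivity
  have h1 := GaussianFourier.integral_rexp_neg_mul_sq_norm (V := EuclideanSpace ℝ (Fin k)) hb
  have hval : Real.pi ^ (-(k : ℝ) / 2) * (Real.pi / (a / h) ^ 2) ^ ((k : ℝ) / 2) = (h / a) ^ k := by
    have e1 : (Real.pi / (a / h) ^ 2) = Real.pi * (h / a) ^ 2 := by field_simp
    rw [e1, Real.mul_rpow Real.pi_pos.le (by positivity), ← mul_assoc, ← Real.rpow_add Real.pi_pos,
      ← Real.rpow_natCast (h / a) 2, ← Real.rpow_mul (by positivity), ← Real.rpow_natCast (h / a) k]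
    have e2 : -(k : ℝ) / 2 + (k : ℝ) / 2 = 0 := by ring
    have e3 : ((2 : ℕ) : ℝ) * ((k : ℝ) / 2) = k := by push_cast; ring
    rw [e2, e3]
    simp
  have hint : Integrable fun v : EuclideanSpace ℝ (Fin k) =>
      Real.exp (-(a / h) ^ 2 * ‖v‖ ^ 2) := by
    -- The integral of a non-integrable function is 0 by convention, so the explicit positive value
    -- proves integrability.
    refine Integrable.of_integral_ne_zero ?_
    rw [h1]
    positivity
  have hfun : ∀ v : EuclideanSpace ℝ (Fin k), gaussKernel k (a * ‖u - v‖ / h) =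
      (fun w => Real.pi ^ (-(k : ℝ) / 2) * Real.exp (-(a / h) ^ 2 * ‖w‖ ^ 2)) (u - v) := by
    intro v
    simp only [gaussKernel]
    congr 2
    ring
  simp_rw [hfun]
  rw [lintegral_sub_left_eq_self (μ := volume)
      (fun w : EuclideanSpace ℝ (Fin k) => ENNReal.ofReal
        (Real.pi ^ (-(k : ℝ) / 2) * Real.exp (-(a / h) ^ 2 * ‖w‖ ^ 2))) u,
    ← ofReal_integral_eq_lintegral_ofReal (hint.const_mul _)
      (Eventually.of_forall fun v => by positivity),
    integral_const_mul, h1]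
  congr 1
  rw [finrank_euclideanSpace, Fintype.card_fin]
  exact hval

/-- At a fixed distance ρ the Gaussian decays faster than any power of h, so distant sample points
contribute nothing at the order h^k. -/
theorem eventually_mul_exp_le (k : ℕ) (A : ℝ) {ρ η : ℝ} (hρ : 0 < ρ) (hη : 0 < η) :
    ∀ᶠ h in 𝓝[>] (0 : ℝ), A * Real.exp (-(ρ / h) ^ 2) ≤ η * h ^ k := by
  have h1 : Tendsto (fun h : ℝ => |A| * ((h⁻¹) ^ k * Real.exp (-h⁻¹))) (𝓝[>] 0) (𝓝 (|A| * 0)) :=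
    ((Real.tendsto_pow_mul_exp_neg_atTop_nhds_zero k).comp tendsto_inv_nhdsGT_zero).const_mul _
  rw [mul_zero] at h1
  have h2 : ∀ᶠ h in 𝓝[>] (0 : ℝ), h < ρ ^ 2 :=
    mem_nhdsWithin_of_mem_nhds (Iio_mem_nhds (by positivity))
  filter_upwards [h1.eventually_lt_const hη, h2, self_mem_nhdsWithin] with h hlt hρ2 (hpos : 0 < h)
  -- Once h < ρ², the Gaussian is dominated by exp(-1/h), to which the limit of t^k exp(-t) applies
  -- with t = 1/h.
  have h3 : h⁻¹ ≤ (ρ / h) ^ 2 := by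
    rw [div_pow, le_div_iff₀ (by positivity)]
    have : h⁻¹ * h ^ 2 = h := by field_simp
    rw [this]
    exact hρ2.le
  calc A * Real.exp (-(ρ / h) ^ 2) ≤ |A| * Real.exp (-h⁻¹) := by
        gcongr
        exact le_abs_self A
    _ = (|A| * ((h⁻¹) ^ k * Real.exp (-h⁻¹))) * h ^ k := by
        have : (h⁻¹) ^ k * h ^ k = 1 := by rw [← mul_pow, inv_mul_cancel₀ hpos.ne', one_pow]
        calc _ = |A| * Real.exp (-h⁻¹) * ((h⁻¹) ^ k * h ^ k) := by rw [this, mul_one]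
          _ = _ := by ring
    _ ≤ η * h ^ k := by gcongr

namespace IsLocalParametrization

variable {d d' : ℕ} {M : Set (EuclideanSpace ℝ (Fin d))} {p : EuclideanSpace ℝ (Fin d)} {ε : ℝ}
  {ψ : EuclideanSpace ℝ (Fin d') → EuclideanSpace ℝ (Fin d)} {r : ℝ}
  {H : Set (EuclideanSpace ℝ (Fin d'))}

theorem measure_image_le (hψ : IsLocalParametrization M p ε ψ r H) (hε : 0 ≤ ε)
    {A : Set (EuclideanSpace ℝ (Fin d'))} (hA : A ⊆ ball 0 r) :
    Measure.euclideanHausdorffMeasure d' (ψ '' A) ≤ ENNReal.ofReal ((1 + ε) ^ d') * volume A := by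
  have h := euclideanHausdorffMeasure_image_le ((hψ.lipschitzOnWith hε).mono hA) d'
  rw [EuclideanSpace.euclideanHausdorffMeasure_eq_volume] at h
  rw [ENNReal.ofReal_pow (by linarith)]
  exact h

/-- The inverse of ψ on the image is Lipschitz with constant 1/(1 - ε), so it multiplies the measure
by at most (1 - ε)^(-d'). -/
theorem le_measure_image (hψ : IsLocalParametrization M p ε ψ r H) (hε : ε < 1)
    {A : Set (EuclideanSpace ℝ (Fin d'))} (hA : A ⊆ ball 0 r) :
    ENNReal.ofReal ((1 - ε) ^ d') * volume A ≤ Measure.euclideanHausdorffMeasure d' (ψ '' A) := by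
  have hε' : 0 < 1 - ε := by linarith
  have hinj := (hψ.injOn hε).mono hA
  have hinv := hinj.leftInvOn_invFunOn
  have hlip : LipschitzOnWith (Real.toNNReal (1 - ε)⁻¹) (Function.invFunOn ψ A) (ψ '' A) := by
    refine LipschitzOnWith.of_dist_le_mul ?_
    rintro _ ⟨u, hu, rfl⟩ _ ⟨v, hv, rfl⟩
    rw [hinv hu, hinv hv, Real.coe_toNNReal _ (by positivity), dist_eq_norm, dist_eq_norm,
      inv_mul_eq_div, le_div_iff₀ hε', mul_comm]
    exact hψ.lower u (hA hu) v (hA hv)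
  have h := euclideanHausdorffMeasure_image_le hlip d'
  rw [hinv.image_image, EuclideanSpace.euclideanHausdorffMeasure_eq_volume] at h
  calc ENNReal.ofReal ((1 - ε) ^ d') * volume A
      ≤ ENNReal.ofReal ((1 - ε) ^ d') * ((Real.toNNReal (1 - ε)⁻¹ : ℝ≥0∞) ^ d' *
          Measure.euclideanHausdorffMeasure d' (ψ '' A)) := by gcongr
    _ = Measure.euclideanHausdorffMeasure d' (ψ '' A) := by
        rw [← mul_assoc]
        have : ENNReal.ofReal ((1 - ε) ^ d') * (Real.toNNReal (1 - ε)⁻¹ : ℝ≥0∞) ^ d' = 1 := by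
          change _ * (ENNReal.ofReal (1 - ε)⁻¹) ^ d' = 1
          rw [← ENNReal.ofReal_pow (by positivity), ← ENNReal.ofReal_mul (by positivity),
            ← mul_pow, mul_inv_cancel₀ hε'.ne', one_pow, ENNReal.ofReal_one]
        rw [this, one_mul]

theorem measurableSet_domain (hψ : IsLocalParametrization M p ε ψ r H) :
    MeasurableSet (ball 0 r ∩ H) := measurableSet_ball.inter hψ.isClosed.measurableSet

theorem aemeasurable (hψ : IsLocalParametrization M p ε ψ r H) :
    AEMeasurable ψ (volume.restrict (ball 0 r ∩ H)) :=
  (hψ.continuousOn.mono inter_subset_left).aemeasurable hψ.measurableSet_domain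

/-- A substitute for the area formula: the Jacobian is only known up to a factor, but the estimates
on sets compare two measures and hence their integrals. -/
theorem lintegral_image_le (hψ : IsLocalParametrization M p ε ψ r H) (hε : 0 ≤ ε)
    {F : EuclideanSpace ℝ (Fin d) → ℝ≥0∞} (hF : Measurable F) :
    ∫⁻ x in ψ '' (ball 0 r ∩ H), F x ∂(Measure.euclideanHausdorffMeasure d') ≤
      ENNReal.ofReal ((1 + ε) ^ d') * ∫⁻ u in ball 0 r ∩ H, F (ψ u) := by
  have hle : (Measure.euclideanHausdorffMeasure d').restrict (ψ '' (ball 0 r ∩ H)) ≤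
      ENNReal.ofReal ((1 + ε) ^ d') • (volume.restrict (ball 0 r ∩ H)).map ψ := by
    refine Measure.le_intro fun B hB _ => ?_
    rw [Measure.restrict_apply hB, Measure.smul_apply, Measure.map_apply_of_aemeasurable
      hψ.aemeasurable hB, Measure.restrict_apply' hψ.measurableSet_domain, smul_eq_mul]
    rw [← image_preimage_inter]
    exact hψ.measure_image_le hε fun u hu => hu.2.1
  calc _ ≤ _ := lintegral_mono' hle le_rfl
    _ = _ := by
      rw [lintegral_smul_measure, lintegral_map' hF.aemeasurable hψ.aemeasurable, smul_eq_mul]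

theorem le_lintegral (hψ : IsLocalParametrization M p ε ψ r H) (hε : ε < 1)
    {F : EuclideanSpace ℝ (Fin d) → ℝ≥0∞} (hF : Measurable F) :
    ENNReal.ofReal ((1 - ε) ^ d') * ∫⁻ u in ball 0 r ∩ H, F (ψ u) ≤
      ∫⁻ x, F x ∂(volumeMeasure d' M) := by
  have hle : ENNReal.ofReal ((1 - ε) ^ d') • (volume.restrict (ball 0 r ∩ H)).map ψ ≤
      volumeMeasure d' M := by
    refine Measure.le_intro fun B hB _ => ?_
    rw [volumeMeasure, Measure.restrict_apply hB, Measure.smul_apply,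
      Measure.map_apply_of_aemeasurable
      hψ.aemeasurable hB, Measure.restrict_apply' hψ.measurableSet_domain, smul_eq_mul]
    refine (hψ.le_measure_image hε fun u hu => hu.2.1).trans (measure_mono ?_)
    rintro _ ⟨u, hu, rfl⟩
    exact ⟨hu.1, hψ.map_mem u hu.2⟩
  calc _ = _ := by
        rw [← smul_eq_mul, ← lintegral_map' hF.aemeasurable hψ.aemeasurable,
          ← lintegral_smul_measure]
    _ ≤ _ := lintegral_mono' hle le_rfl

end IsLocalParametrization

/-! ### Asymptotics of the mean of the estimator -/

theorem densityMeasure_univ {d d' : ℕ} {M : Set (EuclideanSpace ℝ (Fin d))}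
    {f : EuclideanSpace ℝ (Fin d) → ℝ} (hf : IsDensity d' M f) : densityMeasure d' M f univ = 1 := by
  rw [densityMeasure, withDensity_apply _ MeasurableSet.univ, Measure.restrict_univ,
    hf.lintegral_eq_one]

theorem IsDensity.isProbabilityMeasure {d d' : ℕ} {M : Set (EuclideanSpace ℝ (Fin d))}
    {f : EuclideanSpace ℝ (Fin d) → ℝ} (hf : IsDensity d' M f) :
    IsProbabilityMeasure (densityMeasure d' M f) := ⟨densityMeasure_univ hf⟩

theorem measurable_kernel {d : ℕ} (k : ℕ) (x : EuclideanSpace ℝ (Fin d)) (h : ℝ) :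
    Measurable fun y => ENNReal.ofReal (gaussKernel k (‖x - y‖ / h)) :=
  ENNReal.measurable_ofReal.comp
    ((continuous_gaussKernel k).comp (by fun_prop)).measurable

/-- Near p the chart and the continuity of f reduce the integral to a Gaussian one over `H`;
enlarging `H` to ℝ^d' only increases it, so points of ∂M are allowed. The mass far from p is
exponentially small. -/
theorem eventually_lintegral_kernel_le {d d' : ℕ} {M : Set (EuclideanSpace ℝ (Fin d))}
    (hM : IsC2Submanifold d' M) {f : EuclideanSpace ℝ (Fin d) → ℝ}
    (hf : IsDensity d' M f) (hfc : ContinuousOn f M) {p : EuclideanSpace ℝ (Fin d)} (hp : p ∈ M)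
    {c : ℝ} (hc : f p < c) :
    ∀ᶠ z : ℝ × EuclideanSpace ℝ (Fin d) in 𝓝[>] 0 ×ˢ 𝓝[M] p,
      ∫⁻ y, ENNReal.ofReal (gaussKernel d' (‖z.2 - y‖ / z.1)) ∂(densityMeasure d' M f) ≤
        ENNReal.ofReal (c * z.1 ^ d') := by
  -- The gap between f p and c is shared in three: `c₁` bounds f near p, `c₂` also absorbs the
  -- distortion of the chart, and c - c₂ pays for the tail.
  obtain ⟨c₁, hc₁, hc₁c⟩ := exists_between hc
  obtain ⟨c₂, hc₂, hc₂c⟩ := exists_between hc₁c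
  have hc₁0 : 0 < c₁ := (hf.nonneg p hp).trans_lt hc₁
  obtain ⟨ε, hε0, hε1, hεc⟩ : ∃ ε : ℝ, 0 < ε ∧ ε < 1 ∧ c₁ * (1 + ε) ^ d' * (1 / (1 - ε)) ^ d' < c₂ := by
    have hlim : Tendsto (fun ε : ℝ => c₁ * (1 + ε) ^ d' * (1 / (1 - ε)) ^ d') (𝓝 0)
        (𝓝 (c₁ * (1 + 0) ^ d' * (1 / (1 - 0)) ^ d')) := by
      apply ContinuousAt.tendsto (f := fun ε : ℝ => c₁ * (1 + ε) ^ d' * (1 / (1 - ε)) ^ d')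
      fun_prop (disch := norm_num)
    have h1 : ∀ᶠ ε : ℝ in 𝓝 0, c₁ * (1 + ε) ^ d' * (1 / (1 - ε)) ^ d' < c₂ :=
      hlim.eventually_lt_const (by simpa using hc₂)
    have h2 := (h1.and (Iio_mem_nhds (zero_lt_one (α := ℝ)))).filter_mono
      (nhdsWithin_le_nhds (s := Ioi 0))
    obtain ⟨ε, hε, hε'⟩ := (h2.and self_mem_nhdsWithin).exists
    exact ⟨ε, hε', hε.2, hε.1⟩
  obtain ⟨N, hN, hNf⟩ : ∃ N ∈ 𝓝 p, ∀ x ∈ N, x ∈ M → f x < c₁ := by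
    have := (hfc p hp).eventually_lt_const hc₁
    exact ⟨_, eventually_nhdsWithin_iff.1 this, fun x hx => hx⟩
  obtain ⟨ψ, r, H, hψ, hψN⟩ := hM.exists_localParametrization hp hε0 hN
  obtain ⟨ρ, hρ, hρM⟩ := Metric.mem_nhdsWithin_iff.1 hψ.surj
  have hsmall := eventually_mul_exp_le d' 1 (half_pos hρ) (sub_pos.2 hc₂c)
  refine (Filter.Eventually.prod_mk (hsmall.and self_mem_nhdsWithin)
    ((Filter.Eventually.filter_mono nhdsWithin_le_nhds (ball_mem_nhds p (half_pos hρ))).and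
      self_mem_nhdsWithin)).mono ?_
  rintro ⟨h, x⟩ ⟨⟨hexp, hh⟩, hxp, hxM⟩
  simp only at hexp hh hxp hxM ⊢
  have hh : 0 < h := hh
  set q : EuclideanSpace ℝ (Fin d) → ℝ≥0∞ :=
    fun y => ENNReal.ofReal (gaussKernel d' (‖x - y‖ / h)) with hq
  have hqm : Measurable q := measurable_kernel d' x h
  have hxp : dist x p < ρ / 2 := hxp
  have hfar : ∫⁻ y in (ball p ρ)ᶜ, q y ∂(densityMeasure d' M f) ≤
      ENNReal.ofReal (Real.exp (-(ρ / 2 / h) ^ 2)) := by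
    calc _ ≤ ∫⁻ y in (ball p ρ)ᶜ, ENNReal.ofReal (Real.exp (-(ρ / 2 / h) ^ 2))
          ∂(densityMeasure d' M f) := by
          refine setLIntegral_mono measurable_const fun y hy => ENNReal.ofReal_le_ofReal ?_
          have hy' : ρ ≤ dist y p := by simpa using hy
          have hxy : ρ / 2 ≤ ‖x - y‖ := by
            rw [← dist_eq_norm]
            have := dist_triangle_left y p x
            linarith
          have h1 := gaussKernel_anti d' (s := ρ / 2 / h) (t := ‖x - y‖ / h) (by positivity)
            (by gcongr)
          refine h1.trans ?_
          have h2 := gaussKernel_le_one d' 0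
          simp only [gaussKernel] at h2 ⊢
          have h3 := Real.exp_nonneg (-(ρ / 2 / h) ^ 2)
          simp only [ne_eq, OfNat.ofNat_ne_zero, not_false_eq_true, zero_pow, neg_zero,
            Real.exp_zero, mul_one] at h2
          nlinarith
      _ ≤ ENNReal.ofReal (Real.exp (-(ρ / 2 / h) ^ 2)) * densityMeasure d' M f univ := by
          rw [lintegral_const, Measure.restrict_apply_univ]
          exact mul_le_mul' le_rfl (measure_mono (subset_univ _))
      _ = _ := by rw [densityMeasure_univ hf, mul_one]
  obtain ⟨u, hu, hux⟩ := hρM ⟨hxp.trans (by linarith), hxM⟩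
  have hnear : ∫⁻ y in ball p ρ, q y ∂(densityMeasure d' M f) ≤ ENNReal.ofReal (c₂ * h ^ d') := by
    have hsub : ball p ρ ∩ M ⊆ ψ '' (ball 0 r ∩ H) := fun y hy => hρM hy
    calc _ = ∫⁻ y in ball p ρ, (ENNReal.ofReal (f y) * q y) ∂(volumeMeasure d' M) := by
          rw [densityMeasure, restrict_withDensity measurableSet_ball,
            lintegral_withDensity_eq_lintegral_mul_non_measurable₀]
          · rfl
          · exact hf.aemeasurable.ennreal_ofReal.restrict
          · exact Eventually.of_forall fun _ => ENNReal.ofReal_lt_top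
      _ = ∫⁻ y in ball p ρ ∩ M, (ENNReal.ofReal (f y) * q y)
            ∂(Measure.euclideanHausdorffMeasure d') := by
          rw [volumeMeasure, Measure.restrict_restrict measurableSet_ball]
      _ ≤ ∫⁻ y in ball p ρ ∩ M, (ENNReal.ofReal c₁ * q y)
            ∂(Measure.euclideanHausdorffMeasure d') := by
          refine setLIntegral_mono (hqm.const_mul _) fun y hy => ?_
          obtain ⟨v, hv, rfl⟩ := hsub hy
          gcongr
          exact (hNf _ (hψN v hv.1) hy.2).le
      _ ≤ ∫⁻ y in ψ '' (ball 0 r ∩ H), (ENNReal.ofReal c₁ * q y)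
            ∂(Measure.euclideanHausdorffMeasure d') := lintegral_mono_set hsub
      _ ≤ ENNReal.ofReal ((1 + ε) ^ d') * ∫⁻ v in ball 0 r ∩ H, (ENNReal.ofReal c₁ * q (ψ v)) :=
          hψ.lintegral_image_le hε0.le (hqm.const_mul _)
      _ ≤ ENNReal.ofReal ((1 + ε) ^ d') * ∫⁻ v in ball 0 r ∩ H, (ENNReal.ofReal c₁ *
            ENNReal.ofReal (gaussKernel d' ((1 - ε) * ‖u - v‖ / h))) := by
          gcongr 1
          refine setLIntegral_mono' hψ.measurableSet_domain fun v hv => ?_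
          gcongr
          refine ENNReal.ofReal_le_ofReal (gaussKernel_anti d' ?_ ?_)
          · have : 0 < 1 - ε := by linarith
            positivity
          · rw [← hux]
            gcongr
            exact hψ.lower u hu.1 v hv.1
      _ ≤ ENNReal.ofReal ((1 + ε) ^ d') * ∫⁻ v, (ENNReal.ofReal c₁ *
            ENNReal.ofReal (gaussKernel d' ((1 - ε) * ‖u - v‖ / h))) := by
          gcongr 1
          exact setLIntegral_le_lintegral _ _
      _ = ENNReal.ofReal ((1 + ε) ^ d' * (c₁ * (h / (1 - ε)) ^ d')) := by
          have h1 : 0 < 1 - ε := by linarith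
          rw [lintegral_const_mul' _ _ ENNReal.ofReal_ne_top, lintegral_gaussKernel d' h1 hh,
            ← ENNReal.ofReal_mul hc₁0.le, ← ENNReal.ofReal_mul (by positivity)]
      _ ≤ ENNReal.ofReal (c₂ * h ^ d') := by
          apply ENNReal.ofReal_le_ofReal
          have : (1 + ε) ^ d' * (c₁ * (h / (1 - ε)) ^ d') =
              (c₁ * (1 + ε) ^ d' * (1 / (1 - ε)) ^ d') * h ^ d' := by
            rw [div_eq_mul_one_div h, mul_pow]
            ring
          rw [this]
          gcongr
  rw [← lintegral_add_compl q (measurableSet_ball (x := p) (ε := ρ))]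
  calc _ ≤ ENNReal.ofReal (c₂ * h ^ d') + ENNReal.ofReal (Real.exp (-(ρ / 2 / h) ^ 2)) :=
        add_le_add hnear hfar
    _ = ENNReal.ofReal (c₂ * h ^ d' + Real.exp (-(ρ / 2 / h) ^ 2)) := by
        rw [ENNReal.ofReal_add]
        · have : 0 < c₂ := hc₁0.trans hc₂
          positivity
        · positivity
    _ ≤ ENNReal.ofReal (c * h ^ d') := by
        apply ENNReal.ofReal_le_ofReal
        linarith

/-- Outside the ball of radius r, the distance to u is at least r / 2. Part of the Gaussian exponent
there gives a uniform exponentially small factor, and the remainder is a wider Gaussian of finite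
mass. -/
theorem eventually_le_lintegral_gaussKernel (k : ℕ) {a r η : ℝ} (ha : 1 ≤ a) (hr : 0 < r)
    (hη : 0 < η) : ∀ᶠ h in 𝓝[>] (0 : ℝ), ∀ u : EuclideanSpace ℝ (Fin k), ‖u‖ ≤ r / 2 →
      ENNReal.ofReal ((h / a) ^ k - η * h ^ k) ≤
        ∫⁻ v in ball 0 r, ENNReal.ofReal (gaussKernel k (a * ‖u - v‖ / h)) := by
  -- The power 0 is enough: the wider Gaussian, with a / 2 in place of a, has mass (2 / a)^k h^k and
  -- supplies h^k itself.
  have hsmall := eventually_mul_exp_le 0 ((2 / a) ^ k) (ρ := r / 4) (by positivity) hη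
  filter_upwards [hsmall, self_mem_nhdsWithin] with h hexp (hh : 0 < h) u hu
  rw [ENNReal.ofReal_sub _ (by positivity), tsub_le_iff_right,
    ← lintegral_gaussKernel k (by linarith) hh u,
    ← lintegral_add_compl _ (measurableSet_ball (x := (0 : EuclideanSpace ℝ (Fin k))) (ε := r))]
  gcongr
  calc _ ≤ ∫⁻ v in (ball (0 : EuclideanSpace ℝ (Fin k)) r)ᶜ, ENNReal.ofReal
          (Real.exp (-(r / 4 / h) ^ 2)) * ENNReal.ofReal (gaussKernel k (a / 2 * ‖u - v‖ / h)) := by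
        refine setLIntegral_mono' measurableSet_ball.compl fun v hv => ?_
        rw [← ENNReal.ofReal_mul (by positivity)]
        apply ENNReal.ofReal_le_ofReal
        have hv' : r ≤ ‖v‖ := by simpa using hv
        have huv : r / 2 ≤ ‖u - v‖ := by
          have := norm_sub_norm_le v u
          rw [norm_sub_rev] at this
          linarith
        have ht : r / 2 / h ≤ ‖u - v‖ / h := by gcongr
        have ht0 : 0 ≤ r / 2 / h := by positivity
        set t := ‖u - v‖ / h with htdef
        have e1 : a * ‖u - v‖ / h = a * t := by rw [htdef]; ring
        have e2 : a / 2 * ‖u - v‖ / h = a / 2 * t := by rw [htdef]; ring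
        have e3 : r / 4 / h = (r / 2 / h) / 2 := by ring
        rw [e1, e2, e3]
        unfold gaussKernel
        calc _ ≤ Real.pi ^ (-(k : ℝ) / 2) *
              (Real.exp (-(r / 2 / h / 2) ^ 2) * Real.exp (-(a / 2 * t) ^ 2)) := by
              gcongr
              rw [← Real.exp_add]
              gcongr
              have h1 : (r / 2 / h) ^ 2 ≤ t ^ 2 := by gcongr
              have h2 : t ^ 2 ≤ a ^ 2 * t ^ 2 :=
                le_mul_of_one_le_left (sq_nonneg t) (one_le_pow₀ ha)
              nlinarith
          _ = _ := by ring
    _ ≤ ∫⁻ v, ENNReal.ofReal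
          (Real.exp (-(r / 4 / h) ^ 2)) * ENNReal.ofReal (gaussKernel k (a / 2 * ‖u - v‖ / h)) :=
        setLIntegral_le_lintegral _ _
    _ = ENNReal.ofReal (Real.exp (-(r / 4 / h) ^ 2) * (h / (a / 2)) ^ k) := by
        rw [lintegral_const_mul' _ _ ENNReal.ofReal_ne_top,
          lintegral_gaussKernel k (by linarith) hh, ← ENNReal.ofReal_mul (by positivity)]
    _ ≤ ENNReal.ofReal (η * h ^ k) := by
        apply ENNReal.ofReal_le_ofReal
        have : h / (a / 2) = 2 / a * h := by field_simp
        rw [this, mul_pow, ← mul_assoc]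
        rw [pow_zero, mul_one] at hexp
        gcongr
        linarith

/-- Off ∂M the chart is defined on a full ball, which carries almost all of the Gaussian mass.
Points outside the chart can be dropped, as the integrand is nonnegative. -/
theorem eventually_le_lintegral_kernel {d d' : ℕ} {M : Set (EuclideanSpace ℝ (Fin d))}
    (hM : IsC2Submanifold d' M) (hMm : MeasurableSet M) {f : EuclideanSpace ℝ (Fin d) → ℝ}
    (hf : IsDensity d' M f) (hfc : ContinuousOn f M) {p : EuclideanSpace ℝ (Fin d)} (hp : p ∈ M)
    (hpb : p ∉ manifoldBoundary d' M) {c : ℝ} (hc : c < f p) :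
    ∀ᶠ z : ℝ × EuclideanSpace ℝ (Fin d) in 𝓝[>] 0 ×ˢ 𝓝[M] p,
      ENNReal.ofReal (c * z.1 ^ d') ≤
      ∫⁻ y, ENNReal.ofReal (gaussKernel d' (‖z.2 - y‖ / z.1)) ∂(densityMeasure d' M f) := by
  rcases le_or_gt c 0 with hc0 | hc0
  · have : ∀ᶠ z : ℝ × EuclideanSpace ℝ (Fin d) in 𝓝[>] 0 ×ˢ 𝓝[M] p, 0 < z.1 :=
      Filter.Eventually.prod_inl self_mem_nhdsWithin _
    filter_upwards [this] with z hz
    rw [ENNReal.ofReal_of_nonpos (mul_nonpos_of_nonpos_of_nonneg hc0 (by positivity))]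
    exact zero_le
  obtain ⟨c₁, hc₁, hc₁c⟩ := exists_between hc
  have hc₁0 : 0 < c₁ := hc0.trans hc₁
  -- The same ε measures the distortion of the chart and the Gaussian mass lost outside the ball,
  -- the latter being the subtracted term.
  obtain ⟨ε, hε0, hε1, hεc⟩ : ∃ ε : ℝ, 0 < ε ∧ ε < 1 ∧
      c < c₁ * (1 - ε) ^ d' * ((1 / (1 + ε)) ^ d' - ε) := by
    have hlim : Tendsto (fun ε : ℝ => c₁ * (1 - ε) ^ d' * ((1 / (1 + ε)) ^ d' - ε)) (𝓝 0)
        (𝓝 (c₁ * (1 - 0) ^ d' * ((1 / (1 + 0)) ^ d' - 0))) := by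
      apply ContinuousAt.tendsto
        (f := fun ε : ℝ => c₁ * (1 - ε) ^ d' * ((1 / (1 + ε)) ^ d' - ε))
      fun_prop (disch := norm_num)
    have h1 : ∀ᶠ ε : ℝ in 𝓝 0, c < c₁ * (1 - ε) ^ d' * ((1 / (1 + ε)) ^ d' - ε) :=
      hlim.eventually_const_lt (by simpa using hc₁)
    have h2 := (h1.and (Iio_mem_nhds (zero_lt_one (α := ℝ)))).filter_mono
      (nhdsWithin_le_nhds (s := Ioi 0))
    obtain ⟨ε, hε, hε'⟩ := (h2.and self_mem_nhdsWithin).exists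
    exact ⟨ε, hε', hε.2, hε.1⟩
  obtain ⟨N, hNo, hpN, hNf⟩ : ∃ N, IsOpen N ∧ p ∈ N ∧ ∀ x ∈ N, x ∈ M → c₁ < f x := by
    have := (hfc p hp).eventually_const_lt hc₁c
    obtain ⟨N, hN, hNo, hpN⟩ := _root_.eventually_nhds_iff.1 (eventually_nhdsWithin_iff.1 this)
    exact ⟨N, hNo, hpN, hN⟩
  obtain ⟨ψ, r, hψ, hψN⟩ := hM.exists_localParametrization_univ hp hpb hε0 (hNo.mem_nhds hpN)
  have hgauss := eventually_le_lintegral_gaussKernel d' (a := 1 + ε) (by linarith)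
    hψ.radius_pos hε0
  refine (Filter.Eventually.prod_mk (hgauss.and self_mem_nhdsWithin)
    (hψ.eventually_exists_mem_ball hε1 (half_pos hψ.radius_pos))).mono ?_
  rintro ⟨h, x⟩ ⟨⟨hg, hh⟩, u, hu, hux, hur⟩
  simp only at hg hh hux ⊢
  have hh : 0 < h := hh
  set q : EuclideanSpace ℝ (Fin d) → ℝ≥0∞ :=
    fun y => ENNReal.ofReal (gaussKernel d' (‖x - y‖ / h)) with hq
  have hqm : Measurable q := measurable_kernel d' x h
  have h1 : 0 < 1 - ε := by linarith
  have hFm : Measurable (N.indicator fun y => ENNReal.ofReal c₁ * q y) :=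
    (hqm.const_mul _).indicator hNo.measurableSet
  calc ENNReal.ofReal (c * h ^ d')
      ≤ ENNReal.ofReal ((1 - ε) ^ d' * (c₁ * ((h / (1 + ε)) ^ d' - ε * h ^ d'))) := by
        apply ENNReal.ofReal_le_ofReal
        have : (1 - ε) ^ d' * (c₁ * ((h / (1 + ε)) ^ d' - ε * h ^ d')) =
            (c₁ * (1 - ε) ^ d' * ((1 / (1 + ε)) ^ d' - ε)) * h ^ d' := by
          rw [div_eq_mul_one_div h, mul_pow]
          ring
        rw [this]
        gcongr
    _ = ENNReal.ofReal ((1 - ε) ^ d') * (ENNReal.ofReal c₁ *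
          ENNReal.ofReal ((h / (1 + ε)) ^ d' - ε * h ^ d')) := by
        rw [ENNReal.ofReal_mul (by positivity), ENNReal.ofReal_mul hc₁0.le]
    _ ≤ ENNReal.ofReal ((1 - ε) ^ d') * (ENNReal.ofReal c₁ *
          ∫⁻ v in ball 0 r, ENNReal.ofReal (gaussKernel d' ((1 + ε) * ‖u - v‖ / h))) := by
        gcongr
        exact hg u hur.le
    _ = ENNReal.ofReal ((1 - ε) ^ d') * ∫⁻ v in ball 0 r ∩ univ, ENNReal.ofReal c₁ *
          ENNReal.ofReal (gaussKernel d' ((1 + ε) * ‖u - v‖ / h)) := by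
        rw [lintegral_const_mul' _ _ ENNReal.ofReal_ne_top, inter_univ]
    _ ≤ ENNReal.ofReal ((1 - ε) ^ d') * ∫⁻ v in ball 0 r ∩ univ,
          N.indicator (fun y => ENNReal.ofReal c₁ * q y) (ψ v) := by
        gcongr 1
        refine setLIntegral_mono' hψ.measurableSet_domain fun v hv => ?_
        rw [indicator_of_mem (hψN v hv.1)]
        gcongr
        refine ENNReal.ofReal_le_ofReal
          (gaussKernel_anti d' (div_nonneg (norm_nonneg _) hh.le) ?_)
        rw [← hux]
        gcongr
        exact hψ.upper u hu.1 v hv.1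
    _ ≤ ∫⁻ y, N.indicator (fun y => ENNReal.ofReal c₁ * q y) y ∂(volumeMeasure d' M) :=
        hψ.le_lintegral hε1 hFm
    _ ≤ ∫⁻ y, ENNReal.ofReal (f y) * q y ∂(volumeMeasure d' M) := by
        refine lintegral_mono_ae ?_
        filter_upwards [ae_restrict_mem (μ := Measure.euclideanHausdorffMeasure d') hMm] with y hy
        by_cases hyN : y ∈ N
        · rw [indicator_of_mem hyN]
          gcongr
          exact (hNf y hyN hy).le
        · rw [indicator_of_notMem hyN]
          exact zero_le
    _ = ∫⁻ y, q y ∂(densityMeasure d' M f) := by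
        rw [densityMeasure, lintegral_withDensity_eq_lintegral_mul_non_measurable₀]
        · rfl
        · exact hf.aemeasurable.ennreal_ofReal
        · exact Eventually.of_forall fun _ => ENNReal.ofReal_lt_top

theorem integrable_kernel {d : ℕ} (k : ℕ) (ν : Measure (EuclideanSpace ℝ (Fin d)))
    [IsFiniteMeasure ν] (h : ℝ) (x : EuclideanSpace ℝ (Fin d)) :
    Integrable (fun y => gaussKernel k (‖x - y‖ / h)) ν := by
  refine Integrable.of_bound (C := 1) ?_ (Eventually.of_forall fun y => ?_)
  · exact ((continuous_gaussKernel k).comp (by fun_prop)).aestronglyMeasurable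
  · rw [Real.norm_of_nonneg (gaussKernel_nonneg _ _)]
    exact gaussKernel_le_one _ _

/-- The expectation of `K(‖x - Y‖ / h)` when `Y` has law `ν`. -/
def meanKernel {d : ℕ} (k : ℕ) (ν : Measure (EuclideanSpace ℝ (Fin d))) (h : ℝ)
    (x : EuclideanSpace ℝ (Fin d)) : ℝ :=
  ∫ y, gaussKernel k (‖x - y‖ / h) ∂ν

theorem ofReal_meanKernel {d : ℕ} (k : ℕ) (ν : Measure (EuclideanSpace ℝ (Fin d)))
    [IsProbabilityMeasure ν] (h : ℝ) (x : EuclideanSpace ℝ (Fin d)) :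
    ENNReal.ofReal (meanKernel k ν h x) =
      ∫⁻ y, ENNReal.ofReal (gaussKernel k (‖x - y‖ / h)) ∂ν :=
  ofReal_integral_eq_lintegral_ofReal (integrable_kernel k ν h x)
    (Eventually.of_forall fun _ => gaussKernel_nonneg _ _)

theorem meanKernel_nonneg {d : ℕ} (k : ℕ) (ν : Measure (EuclideanSpace ℝ (Fin d))) (h : ℝ)
    (x : EuclideanSpace ℝ (Fin d)) : 0 ≤ meanKernel k ν h x :=
  integral_nonneg fun _ => gaussKernel_nonneg _ _

theorem eventually_meanKernel_le {d d' : ℕ} {M : Set (EuclideanSpace ℝ (Fin d))}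
    (hM : IsC2Submanifold d' M) {f : EuclideanSpace ℝ (Fin d) → ℝ}
    (hf : IsDensity d' M f) (hfc : ContinuousOn f M) {p : EuclideanSpace ℝ (Fin d)} (hp : p ∈ M)
    {c : ℝ} (hc : f p < c) :
    ∀ᶠ z : ℝ × EuclideanSpace ℝ (Fin d) in 𝓝[>] 0 ×ˢ 𝓝[M] p,
      meanKernel d' (densityMeasure d' M f) z.1 z.2 ≤ c * z.1 ^ d' := by
  have := hf.isProbabilityMeasure
  have hpos : ∀ᶠ z : ℝ × EuclideanSpace ℝ (Fin d) in 𝓝[>] 0 ×ˢ 𝓝[M] p, 0 < z.1 :=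
    Filter.Eventually.prod_inl self_mem_nhdsWithin _
  have hc0 : 0 < c := (hf.nonneg p hp).trans_lt hc
  filter_upwards [eventually_lintegral_kernel_le hM hf hfc hp hc, hpos] with z hz hz0
  rw [← ofReal_meanKernel] at hz
  exact (ENNReal.ofReal_le_ofReal_iff (by positivity)).1 hz

theorem eventually_le_meanKernel {d d' : ℕ} {M : Set (EuclideanSpace ℝ (Fin d))}
    (hM : IsC2Submanifold d' M) (hMm : MeasurableSet M) {f : EuclideanSpace ℝ (Fin d) → ℝ}
    (hf : IsDensity d' M f) (hfc : ContinuousOn f M) {p : EuclideanSpace ℝ (Fin d)} (hp : p ∈ M)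
    (hpb : p ∉ manifoldBoundary d' M) {c : ℝ} (hc : c < f p) :
    ∀ᶠ z : ℝ × EuclideanSpace ℝ (Fin d) in 𝓝[>] 0 ×ˢ 𝓝[M] p,
      c * z.1 ^ d' ≤ meanKernel d' (densityMeasure d' M f) z.1 z.2 := by
  have := hf.isProbabilityMeasure
  filter_upwards [eventually_le_lintegral_kernel hM hMm hf hfc hp hpb hc] with z hz
  rw [← ofReal_meanKernel] at hz
  exact (ENNReal.ofReal_le_ofReal_iff (meanKernel_nonneg _ _ _ _)).1 hz

/-! ### Chernoff bound -/

/-- Here exp(t) ≤ 1 + t + t² for |t| ≤ 1, and y² ≤ y on [0, 1]: the second moment is controlled by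
the mean. -/
theorem exp_mul_le_of_mem_unitInterval {s y : ℝ} (hs : |s| ≤ 1) (hy0 : 0 ≤ y) (hy1 : y ≤ 1) :
    Real.exp (s * y) ≤ 1 + (s + s ^ 2) * y := by
  have h1 : |s * y| ≤ 1 := by
    rw [abs_mul, abs_of_nonneg hy0]
    exact mul_le_one₀ hs hy0 hy1
  have h2 := (abs_le.1 (Real.abs_exp_sub_one_sub_id_le h1)).2
  nlinarith [mul_nonneg (mul_nonneg (sq_nonneg s) hy0) (sub_nonneg.2 hy1)]

section Chernoff

variable {Ω : Type*} [MeasurableSpace Ω] {P : Measure Ω} [IsProbabilityMeasure P]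
  {Y : ℕ → Ω → ℝ} {m : ℝ}

theorem integrable_exp_mul_of_bounded {Z : Ω → ℝ} (hZ : Measurable Z) {b : ℝ}
    (hb : ∀ ω, |Z ω| ≤ b) (s : ℝ) : Integrable (fun ω => Real.exp (s * Z ω)) P := by
  refine Integrable.of_bound (C := Real.exp (|s| * b)) (by fun_prop)
    (Eventually.of_forall fun ω => ?_)
  rw [Real.norm_eq_abs, Real.abs_exp]
  refine Real.exp_le_exp.2 ?_
  calc s * Z ω ≤ |s * Z ω| := le_abs_self _
    _ ≤ |s| * b := by
      rw [abs_mul]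
      gcongr
      exact hb ω

theorem mgf_le_of_mem_unitInterval {Z : Ω → ℝ} (hZ : Measurable Z) (h0 : ∀ ω, 0 ≤ Z ω)
    (h1 : ∀ ω, Z ω ≤ 1) (hm : ∫ ω, Z ω ∂P = m) {s : ℝ} (hs : |s| ≤ 1) :
    mgf Z P s ≤ Real.exp ((s + s ^ 2) * m) := by
  have hb : ∀ ω, |Z ω| ≤ 1 := fun ω => by
    rw [abs_of_nonneg (h0 ω)]
    exact h1 ω
  have hint : Integrable Z P := Integrable.of_bound hZ.aestronglyMeasurable 1
    (Eventually.of_forall hb)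
  calc mgf Z P s ≤ ∫ ω, (1 + (s + s ^ 2) * Z ω) ∂P := by
        refine integral_mono (integrable_exp_mul_of_bounded hZ hb s)
          ((integrable_const _).add (hint.const_mul _)) fun ω => ?_
        exact exp_mul_le_of_mem_unitInterval hs (h0 ω) (h1 ω)
    _ = (s + s ^ 2) * m + 1 := by
        rw [integral_add (integrable_const _) (hint.const_mul _), integral_const_mul, hm]
        simp [add_comm]
    _ ≤ _ := Real.add_one_le_exp _

/-- A Chernoff bound for sums of independent variables in `[0, 1]`, which takes into account that
their mean is small. -/
theorem measureReal_abs_sum_sub_ge_le (hY : ∀ i, Measurable (Y i)) (hind : iIndepFun Y P)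
    (h0 : ∀ i ω, 0 ≤ Y i ω) (h1 : ∀ i ω, Y i ω ≤ 1) (hm : ∀ i, ∫ ω, Y i ω ∂P = m) (n : ℕ)
    {s : ℝ} (hs0 : 0 ≤ s) (hs1 : s ≤ 1) (τ : ℝ) :
    P.real {ω | τ ≤ |∑ i ∈ Finset.range n, Y i ω - n * m|} ≤
      2 * Real.exp (n * (s ^ 2 * m) - s * τ) := by
  set S : Ω → ℝ := ∑ i ∈ Finset.range n, Y i with hS
  have hSval : ∀ ω, S ω = ∑ i ∈ Finset.range n, Y i ω := fun ω => by simp [hS]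
  have hSm : Measurable S := by
    rw [funext hSval]
    exact Finset.measurable_sum _ fun i _ => hY i
  have hSb : ∀ ω, |S ω| ≤ n := fun ω => by
    rw [hSval, abs_of_nonneg (Finset.sum_nonneg fun i _ => h0 i ω)]
    calc _ ≤ ∑ i ∈ Finset.range n, (1 : ℝ) := Finset.sum_le_sum fun i _ => h1 i ω
      _ = n := by simp
  -- Used with t = s for the upper tail and t = -s for the lower one; the linear term cancels the
  -- centring n m and leaves n s² m.
  have hmgf : ∀ t : ℝ, |t| ≤ 1 → mgf S P t ≤ Real.exp (n * ((t + t ^ 2) * m)) := by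
    intro t ht
    rw [hS, hind.mgf_sum hY, Real.exp_nat_mul]
    calc _ ≤ ∏ i ∈ Finset.range n, Real.exp ((t + t ^ 2) * m) :=
          Finset.prod_le_prod (fun _ _ => mgf_nonneg) fun i _ =>
            mgf_le_of_mem_unitInterval (hY i) (h0 i) (h1 i) (hm i) ht
      _ = _ := by simp
  have hup : P.real {ω | n * m + τ ≤ S ω} ≤ Real.exp (n * (s ^ 2 * m) - s * τ) := by
    refine (measure_ge_le_exp_mul_mgf _ hs0 (integrable_exp_mul_of_bounded hSm hSb s)).trans ?_
    refine (mul_le_mul_of_nonneg_left (hmgf s (by rwa [abs_of_nonneg hs0]))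
      (Real.exp_nonneg _)).trans ?_
    rw [← Real.exp_add]
    apply le_of_eq
    congr 1
    ring
  have hlow : P.real {ω | S ω ≤ n * m - τ} ≤ Real.exp (n * (s ^ 2 * m) - s * τ) := by
    refine (measure_le_le_exp_mul_mgf _ (neg_nonpos.2 hs0)
      (integrable_exp_mul_of_bounded hSm hSb (-s))).trans ?_
    refine (mul_le_mul_of_nonneg_left (hmgf (-s) (by rwa [abs_neg, abs_of_nonneg hs0]))
      (Real.exp_nonneg _)).trans ?_
    rw [← Real.exp_add]
    apply le_of_eq
    congr 1
    ring
  have hsub : {ω | τ ≤ |∑ i ∈ Finset.range n, Y i ω - n * m|} ⊆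
      {ω | n * m + τ ≤ S ω} ∪ {ω | S ω ≤ n * m - τ} := by
    intro ω hω
    have hω : τ ≤ |∑ i ∈ Finset.range n, Y i ω - n * m| := hω
    rw [← hSval, le_abs] at hω
    rcases hω with h | h
    · left
      change n * m + τ ≤ S ω
      linarith
    · right
      change S ω ≤ n * m - τ
      linarith
  calc _ ≤ P.real ({ω | n * m + τ ≤ S ω} ∪ {ω | S ω ≤ n * m - τ}) := measureReal_mono hsub
    _ ≤ _ := measureReal_union_le _ _
    _ ≤ _ := by linarith

end Chernoff

/-! ### Uniform almost sure deviation of the estimator from its mean -/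

/-- A bounded set in `ℝ^d` has finite nets of mesh `√d / m` with `O(m^d)` points. -/
theorem exists_finite_net {d : ℕ} {M : Set (EuclideanSpace ℝ (Fin d))}
    (hM : Bornology.IsBounded M) :
    ∃ B : ℕ, ∀ m : ℕ, 0 < m → ∃ T : Finset (EuclideanSpace ℝ (Fin d)), (∀ y ∈ T, y ∈ M) ∧
      T.card ≤ (B * m) ^ d ∧ ∀ x ∈ M, ∃ y ∈ T, ‖x - y‖ ≤ √d / m := by
  classical
  obtain ⟨R₀, hR₀⟩ := hM.exists_norm_le
  obtain ⟨R, hR⟩ := exists_nat_ge R₀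
  refine ⟨2 * R + 1, fun m hm => ?_⟩
  have hm0 : (0 : ℝ) < m := by exact_mod_cast hm
  let φ : EuclideanSpace ℝ (Fin d) → Fin d → ℤ := fun x i => ⌊(m : ℝ) * x i⌋
  let G : Finset (Fin d → ℤ) :=
    Fintype.piFinset fun _ => Finset.Icc (-(R * m : ℤ)) (R * m)
  -- One point of `M` is chosen in each occupied cell of the grid of mesh 1 / m. The default 0 never
  -- enters the net, which ranges over occupied cells only.
  let g : (Fin d → ℤ) → EuclideanSpace ℝ (Fin d) := fun z =>
    if hz : ∃ x ∈ M, φ x = z then hz.choose else 0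
  have hg : ∀ z, (∃ x ∈ M, φ x = z) → g z ∈ M ∧ φ (g z) = z := fun z hz => by
    simp only [g, dif_pos hz]
    exact hz.choose_spec
  refine ⟨(G.filter fun z => ∃ x ∈ M, φ x = z).image g, ?_, ?_, ?_⟩
  · intro y hy
    obtain ⟨z, hz, rfl⟩ := Finset.mem_image.1 hy
    exact (hg z (Finset.mem_filter.1 hz).2).1
  · calc _ ≤ (G.filter fun z => ∃ x ∈ M, φ x = z).card := Finset.card_image_le
      _ ≤ G.card := Finset.card_filter_le _ _
      _ = (2 * (R * m) + 1) ^ d := by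
          have : ((R * m : ℤ) + 1 - -(R * m : ℤ)).toNat = 2 * (R * m) + 1 := by
            have h1 : ((R * m : ℤ) + 1 - -(R * m : ℤ)) = ((2 * (R * m) + 1 : ℕ) : ℤ) := by
              push_cast
              ring
            rw [h1, Int.toNat_natCast]
          simp only [G, Fintype.card_piFinset, Int.card_Icc, this]
          simp
      _ ≤ ((2 * R + 1) * m) ^ d := by
          apply Nat.pow_le_pow_left
          nlinarith
  · intro x hx
    have hxz : ∃ x' ∈ M, φ x' = φ x := ⟨x, hx, rfl⟩
    refine ⟨g (φ x), Finset.mem_image.2 ⟨φ x, Finset.mem_filter.2 ⟨?_, hxz⟩, rfl⟩, ?_⟩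
    · refine Fintype.mem_piFinset.2 fun i => Finset.mem_Icc.2 ?_
      have hxi : |x i| ≤ R := by
        have h1 := PiLp.norm_apply_le x i
        rw [Real.norm_eq_abs] at h1
        exact h1.trans ((hR₀ x hx).trans hR)
      obtain ⟨h1, h2⟩ := abs_le.1 hxi
      constructor
      · apply Int.le_floor.2
        push_cast
        nlinarith
      · have : (⌊(m : ℝ) * x i⌋ : ℝ) ≤ R * m := (Int.floor_le _).trans (by nlinarith)
        exact_mod_cast this
    · obtain ⟨-, hgz⟩ := hg _ hxz
      set y := g (φ x)
      have hcoord : ∀ i, ‖(x - y) i‖ ≤ 1 / m := fun i => by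
        have h1 : ⌊(m : ℝ) * y i⌋ = ⌊(m : ℝ) * x i⌋ := congrFun hgz i
        have h2 := Int.abs_sub_lt_one_of_floor_eq_floor h1.symm
        rw [← mul_sub, abs_mul, abs_of_pos hm0] at h2
        rw [Real.norm_eq_abs, PiLp.sub_apply, le_div_iff₀ hm0]
        linarith
      rw [EuclideanSpace.norm_eq]
      calc √(∑ i, ‖(x - y) i‖ ^ 2) ≤ √(∑ _i : Fin d, (1 / m : ℝ) ^ 2) := by
            gcongr with i
            exact hcoord i
        _ = √d / m := by
            rw [Finset.sum_const, Finset.card_univ, Fintype.card_fin, nsmul_eq_mul,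
              Real.sqrt_mul (by positivity), Real.sqrt_sq (by positivity)]
            ring

/-- The derivative is at most 1 in absolute value because |2x| ≤ 1 + x² ≤ exp(x²). -/
theorem abs_gaussKernel_sub_le (k : ℕ) (s t : ℝ) :
    |gaussKernel k s - gaussKernel k t| ≤ |s - t| := by
  have hderiv : ∀ x ∈ (univ : Set ℝ), HasDerivWithinAt (gaussKernel k)
      (Real.pi ^ (-(k : ℝ) / 2) * (Real.exp (-x ^ 2) * (-(2 * x)))) univ x := by
    intro x _
    have h1 : HasDerivAt (fun x : ℝ => -x ^ 2) (-(2 * x)) x := by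
      simpa using (hasDerivAt_pow 2 x).fun_neg
    exact (h1.exp.const_mul _).hasDerivWithinAt
  have hbound : ∀ x ∈ (univ : Set ℝ),
      ‖Real.pi ^ (-(k : ℝ) / 2) * (Real.exp (-x ^ 2) * (-(2 * x)))‖ ≤ 1 := by
    intro x _
    have h0 : Real.pi ^ (-(k : ℝ) / 2) * Real.exp (-x ^ 2) = gaussKernel k x := rfl
    rw [← mul_assoc, h0, norm_mul, Real.norm_of_nonneg (gaussKernel_nonneg k x), norm_neg,
      Real.norm_eq_abs]
    have h1 : |2 * x| ≤ Real.exp (x ^ 2) := by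
      have h2 := Real.add_one_le_exp (x ^ 2)
      rw [abs_le]
      constructor <;> nlinarith [sq_nonneg (x - 1), sq_nonneg (x + 1)]
    have h3 : gaussKernel k x ≤ Real.exp (-x ^ 2) := by
      have h4 : Real.pi ^ (-(k : ℝ) / 2) ≤ 1 := by
        simpa [gaussKernel] using gaussKernel_le_one k 0
      unfold gaussKernel
      nlinarith [Real.exp_nonneg (-x ^ 2)]
    calc gaussKernel k x * |2 * x| ≤ Real.exp (-x ^ 2) * Real.exp (x ^ 2) := by gcongr
      _ = 1 := by rw [← Real.exp_add]; simp
  have := convex_univ.norm_image_sub_le_of_norm_hasDerivWithin_le hderiv hbound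
    (mem_univ t) (mem_univ s)
  simpa [Real.norm_eq_abs] using this

theorem abs_gaussKernel_norm_sub_le {d : ℕ} (k : ℕ) {h : ℝ} (hh : 0 < h)
    (x y z : EuclideanSpace ℝ (Fin d)) :
    |gaussKernel k (‖x - z‖ / h) - gaussKernel k (‖y - z‖ / h)| ≤ ‖x - y‖ / h := by
  refine (abs_gaussKernel_sub_le _ _ _).trans ?_
  rw [← sub_div, abs_div, abs_of_pos hh]
  gcongr
  have := abs_norm_sub_norm_le (x - z) (y - z)
  rwa [sub_sub_sub_cancel_right] at this

theorem abs_kde_sub_kde_le {d : ℕ} (k : ℕ) {h : ℝ} (hh : 0 < h) {n : ℕ} (hn : 0 < n)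
    (X : ℕ → EuclideanSpace ℝ (Fin d)) (x y : EuclideanSpace ℝ (Fin d)) :
    |kde k h n X x - kde k h n X y| ≤ ‖x - y‖ / h ^ (k + 1) := by
  have hn0 : (0 : ℝ) < n := by exact_mod_cast hn
  rw [kde, kde, ← mul_sub, ← Finset.sum_sub_distrib, abs_mul, abs_of_pos (by positivity)]
  calc _ ≤ 1 / (n * h ^ k) * ∑ i ∈ Finset.range n, ‖x - y‖ / h := by
        gcongr
        exact (Finset.abs_sum_le_sum_abs _ _).trans
          (Finset.sum_le_sum fun i _ => abs_gaussKernel_norm_sub_le k hh x y (X i))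
    _ = ‖x - y‖ / h ^ (k + 1) := by
        rw [Finset.sum_const, Finset.card_range, nsmul_eq_mul]
        field_simp
        ring

theorem abs_meanKernel_sub_le {d : ℕ} (k : ℕ) (ν : Measure (EuclideanSpace ℝ (Fin d)))
    [IsProbabilityMeasure ν] {h : ℝ} (hh : 0 < h) (x y : EuclideanSpace ℝ (Fin d)) :
    |meanKernel k ν h x - meanKernel k ν h y| ≤ ‖x - y‖ / h := by
  rw [meanKernel, meanKernel, ← integral_sub (integrable_kernel k ν h x) (integrable_kernel k ν h y)]
  have := norm_integral_le_of_norm_le_const (μ := ν) (C := ‖x - y‖ / h)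
    (f := fun z => gaussKernel k (‖x - z‖ / h) - gaussKernel k (‖y - z‖ / h))
    (Eventually.of_forall fun z => abs_gaussKernel_norm_sub_le k hh x y z)
  simpa using this

section Deviation

variable {d k : ℕ} {Ω : Type*} [MeasurableSpace Ω] {P : Measure Ω} [IsProbabilityMeasure P]
  {X : ℕ → Ω → EuclideanSpace ℝ (Fin d)} {ν : Measure (EuclideanSpace ℝ (Fin d))}

/-- With the mean at most C h^k and the deviation τ = n h^k η, both terms of the Chernoff exponent
scale like n h^k. A bound blind to the mean, such as Hoeffding's, would only give n h^(2k). -/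
theorem measureReal_abs_kde_sub_ge_le (hXm : ∀ i, Measurable (X i)) (hXi : iIndepFun X P)
    (hX : ∀ i, P.map (X i) = ν) {h : ℝ} (hh : 0 < h) {n : ℕ} (hn : 0 < n)
    (x : EuclideanSpace ℝ (Fin d)) {C η : ℝ}
    (hC : meanKernel k ν h x ≤ C * h ^ k) {s : ℝ} (hs0 : 0 ≤ s) (hs1 : s ≤ 1) :
    P.real {ω | η ≤ |kde k h n (fun i => X i ω) x - meanKernel k ν h x / h ^ k|} ≤
      2 * Real.exp (-((s * η - s ^ 2 * C) * (n * h ^ k))) := by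
  have hn0 : (0 : ℝ) < n := by exact_mod_cast hn
  have hcm : Measurable fun y : EuclideanSpace ℝ (Fin d) => gaussKernel k (‖x - y‖ / h) :=
    ((continuous_gaussKernel k).comp (by fun_prop)).measurable
  have hb := measureReal_abs_sum_sub_ge_le (P := P)
    (Y := fun i ω => gaussKernel k (‖x - X i ω‖ / h)) (m := meanKernel k ν h x)
    (fun i => hcm.comp (hXm i)) (hXi.comp (fun _ y => gaussKernel k (‖x - y‖ / h)) fun _ => hcm)
    (fun _ _ => gaussKernel_nonneg _ _) (fun _ _ => gaussKernel_le_one _ _)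
    (fun i => by
      rw [meanKernel, ← hX i, integral_map (hXm i).aemeasurable hcm.aestronglyMeasurable]) n
    hs0 hs1 (n * h ^ k * η)
  have hset : {ω | η ≤ |kde k h n (fun i => X i ω) x - meanKernel k ν h x / h ^ k|} =
      {ω | n * h ^ k * η ≤
        |∑ i ∈ Finset.range n, gaussKernel k (‖x - X i ω‖ / h) - n * meanKernel k ν h x|} := by
    ext ω
    have hnh : 0 < n * h ^ k := by positivity
    have : kde k h n (fun i => X i ω) x - meanKernel k ν h x / h ^ k =
        (∑ i ∈ Finset.range n, gaussKernel k (‖x - X i ω‖ / h) - n * meanKernel k ν h x) /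
          (n * h ^ k) := by
      rw [kde]
      field_simp
    simp only [mem_ofPred_eq, this, abs_div, abs_of_pos hnh]
    rw [le_div_iff₀ hnh, mul_comm]
  rw [hset]
  refine hb.trans ?_
  gcongr
  have : s ^ 2 * meanKernel k ν h x ≤ s ^ 2 * (C * h ^ k) := by gcongr
  nlinarith

/-- The uniform almost sure convergence of the kernel density estimator to its mean. -/
theorem ae_eventually_abs_kde_sub_le (hk : k ≠ 0) {M : Set (EuclideanSpace ℝ (Fin d))}
    (hM : Bornology.IsBounded M) [IsProbabilityMeasure ν]
    (hXm : ∀ i, Measurable (X i)) (hXi : iIndepFun X P)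
    (hX : ∀ i, P.map (X i) = ν) {h : ℕ → ℝ} (hh : ∀ n, 0 < h n) (hh0 : Tendsto h atTop (𝓝 0))
    (hnh : ∀ A : ℝ, ∀ᶠ n : ℕ in atTop, A * Real.log n ≤ n * h n ^ k) {C : ℝ}
    (hC : ∀ᶠ n in atTop, ∀ x ∈ M, meanKernel k ν (h n) x ≤ C * h n ^ k) :
    ∀ᵐ ω ∂P, ∀ η > 0, ∀ᶠ n in atTop, ∀ x ∈ M,
      |kde k (h n) n (fun i => X i ω) x - meanKernel k ν (h n) x / h n ^ k| < η := by
  -- Countably many values of η suffice. In 3η, one η is the deviation at a net point and two pay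
  -- for moving the estimator and its mean from x to that point.
  suffices H : ∀ η > 0, ∀ᵐ ω ∂P, ∀ᶠ n in atTop, ∀ x ∈ M,
      |kde k (h n) n (fun i => X i ω) x - meanKernel k ν (h n) x / h n ^ k| < 3 * η by
    have H' : ∀ᵐ ω ∂P, ∀ j : ℕ, ∀ᶠ n in atTop, ∀ x ∈ M,
        |kde k (h n) n (fun i => X i ω) x - meanKernel k ν (h n) x / h n ^ k| <
          3 * (1 / (j + 1 : ℝ)) := ae_all_iff.2 fun j => H _ (by positivity)
    filter_upwards [H'] with ω hω η hη
    obtain ⟨j, hj⟩ := exists_nat_one_div_lt (div_pos hη (by norm_num : (0 : ℝ) < 3))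
    filter_upwards [hω j] with n hn x hx
    refine (hn x hx).trans ?_
    linarith
  intro η hη
  obtain ⟨B, hB⟩ := exists_finite_net hM
  set C' := max C 1 with hC'
  have hC'1 : 1 ≤ C' := le_max_right _ _
  -- With this s the exponent sη - s²C' is at least sη / 2.
  obtain ⟨s, hs0, hs1, hsC⟩ : ∃ s : ℝ, 0 < s ∧ s ≤ 1 ∧ s * C' ≤ η / 2 := by
    refine ⟨min 1 (η / (2 * C')), by positivity, min_le_left _ _, ?_⟩
    calc _ ≤ η / (2 * C') * C' := by gcongr; exact min_le_right _ _
      _ = η / 2 := by field_simp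
  obtain ⟨B', hB'⟩ := exists_nat_ge (√d / η)
  set q : ℝ := ((B * (B' + 1) : ℕ) : ℝ) ^ d with hq
  have hbound : ∀ᶠ n : ℕ in atTop, P.real {ω | ∃ x ∈ M, 3 * η ≤
      |kde k (h n) n (fun i => X i ω) x - meanKernel k ν (h n) x / h n ^ k|} ≤
        2 * q * (1 / (n : ℝ) ^ 2) := by
    -- The constant in the second use of `hnh` makes each net point fail with probability at most 2
    -- n^(-(2d+2)). The net has at most q n^(2d) points, which leaves the summable 2q / n².
    filter_upwards [hC, hh0.eventually_lt_const zero_lt_one, hnh 1,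
      hnh ((2 * d + 2) / (s * η / 2)), eventually_ge_atTop 3] with n hCn hn1 hlog hbig hn3
    have hn0 : (0 : ℝ) < n := by
      have : 0 < n := by lia
      exact_mod_cast this
    have hhn := hh n
    have hlog1 : 1 ≤ Real.log n := by
      rw [Real.le_log_iff_exp_le hn0]
      have h3 : (3 : ℝ) ≤ n := by exact_mod_cast hn3
      linarith [Real.exp_one_lt_three]
    have hnk : 1 ≤ n * h n ^ k := by linarith
    -- This uses k ≥ 1 and h < 1. With n h^k ≥ 1 it gives n² h^(k+1) ≥ 1, so a mesh of order n^(-2)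
    -- compensates for the Lipschitz constant h^(-(k+1)).
    have hnh1 : 1 ≤ n * h n := by
      have : h n ^ k ≤ h n := pow_le_of_le_one hhn.le hn1.le hk
      nlinarith
    have hhk : 1 ≤ (n : ℝ) ^ 2 * h n ^ (k + 1) := by
      calc (1 : ℝ) = 1 * 1 := by ring
        _ ≤ (n * h n ^ k) * (n * h n) := by gcongr
        _ = _ := by ring
    obtain ⟨T, hTM, hTc, hTn⟩ := hB ((B' + 1) * n ^ 2) (by positivity)
    have hsub : {ω | ∃ x ∈ M, 3 * η ≤
        |kde k (h n) n (fun i => X i ω) x - meanKernel k ν (h n) x / h n ^ k|} ⊆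
        ⋃ y ∈ T, {ω | η ≤
          |kde k (h n) n (fun i => X i ω) y - meanKernel k ν (h n) y / h n ^ k|} := by
      rintro ω ⟨x, hx, hxω⟩
      obtain ⟨y, hy, hxy⟩ := hTn x hx
      simp only [mem_iUnion]
      refine ⟨y, hy, ?_⟩
      have hd : ‖x - y‖ / h n ^ (k + 1) ≤ η := by
        rw [div_le_iff₀ (by positivity)]
        refine hxy.trans ?_
        rw [div_le_iff₀ (by positivity)]
        push_cast
        have h1 : √d ≤ η * (B' + 1) := by
          rw [div_le_iff₀ hη] at hB'
          linarith
        calc √d ≤ η * (B' + 1) * 1 := by linarith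
          _ ≤ η * (B' + 1) * ((n : ℝ) ^ 2 * h n ^ (k + 1)) := by gcongr
          _ = _ := by ring
      have h1 := abs_kde_sub_kde_le k hhn (by lia : 0 < n) (fun i => X i ω) x y
      have h2 : |meanKernel k ν (h n) x / h n ^ k - meanKernel k ν (h n) y / h n ^ k| ≤
          ‖x - y‖ / h n ^ (k + 1) := by
        rw [← sub_div, abs_div, abs_of_pos (pow_pos hhn k), pow_succ', ← div_div]
        gcongr
        exact abs_meanKernel_sub_le k ν hhn x y
      change η ≤ _
      have h3 := abs_le.1 (h1.trans hd)
      have h4 := abs_le.1 (h2.trans hd)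
      rw [le_abs] at hxω ⊢
      rcases hxω with h5 | h5
      · left; linarith [h3.2, h4.1]
      · right; linarith [h3.1, h4.2]
    have hexp : Real.exp (-((s * η - s ^ 2 * C') * (n * h n ^ k))) ≤
        1 / (n : ℝ) ^ (2 * d + 2) := by
      have h1 : s * η / 2 ≤ s * η - s ^ 2 * C' := by nlinarith
      have h2 : (2 * d + 2) * Real.log n ≤ s * η / 2 * (n * h n ^ k) := by
        have hpos : 0 < s * η / 2 := by positivity
        have := mul_le_mul_of_nonneg_left hbig hpos.le
        calc _ = s * η / 2 * ((2 * d + 2) / (s * η / 2) * Real.log n) := by field_simp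
          _ ≤ _ := this
      have h3 : s * η / 2 * (n * h n ^ k) ≤ (s * η - s ^ 2 * C') * (n * h n ^ k) := by gcongr
      have h4 : Real.exp (-((2 * d + 2 : ℕ) * Real.log n)) = 1 / (n : ℝ) ^ (2 * d + 2) := by
        rw [Real.exp_neg, Real.exp_nat_mul, Real.exp_log hn0, one_div]
      rw [← h4]
      refine Real.exp_le_exp.2 (neg_le_neg ?_)
      push_cast
      linarith
    calc _ ≤ P.real (⋃ y ∈ T, {ω | η ≤
          |kde k (h n) n (fun i => X i ω) y - meanKernel k ν (h n) y / h n ^ k|}) :=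
          measureReal_mono hsub (measure_ne_top _ _)
      _ ≤ ∑ y ∈ T, P.real {ω | η ≤
          |kde k (h n) n (fun i => X i ω) y - meanKernel k ν (h n) y / h n ^ k|} :=
          measureReal_biUnion_finset_le _ _
      _ ≤ ∑ y ∈ T, 2 * Real.exp (-((s * η - s ^ 2 * C') * (n * h n ^ k))) := by
          refine Finset.sum_le_sum fun y hy => ?_
          refine measureReal_abs_kde_sub_ge_le hXm hXi hX hhn (by lia) y
            ((hCn y (hTM y hy)).trans ?_) hs0.le hs1
          gcongr
          exact le_max_left _ _
      _ ≤ ∑ y ∈ T, 2 * (1 / (n : ℝ) ^ (2 * d + 2)) := by gcongr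
      _ = T.card * (2 * (1 / (n : ℝ) ^ (2 * d + 2))) := by
          rw [Finset.sum_const, nsmul_eq_mul]
      _ ≤ (q * (n : ℝ) ^ (2 * d)) * (2 * (1 / (n : ℝ) ^ (2 * d + 2))) := by
          gcongr
          have h1 : (T.card : ℝ) ≤ (((B * ((B' + 1) * n ^ 2)) ^ d : ℕ) : ℝ) := by exact_mod_cast hTc
          refine h1.trans (le_of_eq ?_)
          rw [hq]
          push_cast
          rw [pow_mul, ← mul_pow]
          ring
      _ = _ := by
          rw [pow_add]
          field_simp
  obtain ⟨N, hN⟩ := eventually_atTop.1 hbound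
  -- Borel–Cantelli for the sequence shifted by N, since the bound holds only from N on. The events
  -- involve all x in `M`, and no measurability is needed for them.
  have hsum : ∑' n : ℕ, P {ω | ∃ x ∈ M, 3 * η ≤
      |kde k (h (n + N)) (n + N) (fun i => X i ω) x -
        meanKernel k ν (h (n + N)) x / h (n + N) ^ k|} ≠ ∞ := by
    have hs : Summable fun n : ℕ => 2 * q * (1 / ((n + N : ℕ) : ℝ) ^ 2) :=
      ((summable_nat_add_iff N).2 (Real.summable_one_div_nat_pow.2 one_lt_two)).mul_left (2 * q)
    have hle : ∀ n : ℕ, P {ω | ∃ x ∈ M, 3 * η ≤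
        |kde k (h (n + N)) (n + N) (fun i => X i ω) x -
          meanKernel k ν (h (n + N)) x / h (n + N) ^ k|} ≤
        ENNReal.ofReal (2 * q * (1 / ((n + N : ℕ) : ℝ) ^ 2)) := by
      intro n
      rw [← ofReal_measureReal]
      exact ENNReal.ofReal_le_ofReal (hN (n + N) (by lia))
    refine ne_top_of_le_ne_top ?_ (ENNReal.tsum_le_tsum hle)
    rw [← ENNReal.ofReal_tsum_of_nonneg (fun n => by positivity) hs]
    exact ENNReal.ofReal_ne_top
  filter_upwards [ae_eventually_notMem hsum] with ω hω
  obtain ⟨N', hN'⟩ := eventually_atTop.1 hω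
  filter_upwards [eventually_ge_atTop (N' + N)] with n hn x hx
  have := hN' (n - N) (by lia)
  rw [Nat.sub_add_cancel (by lia : N ≤ n)] at this
  by_contra hcon
  exact this ⟨x, hx, not_lt.1 hcon⟩

end Deviation

/-! ### Deterministic convergence of level sets -/

/-- A finite subcover needs only finitely many "eventually". All later uniformity over `M` comes
from this, so each argument reduces to one neighbourhood of one point. -/
theorem _root_.IsCompact.eventually_forall_of_nhdsWithin {X ι : Type*} [TopologicalSpace X]
    {K : Set X} (hK : IsCompact K) {F : Filter ι} {R : ι → X → Prop}
    (hR : ∀ p ∈ K, ∃ t ∈ 𝓝[K] p, ∀ᶠ n in F, ∀ x ∈ t, R n x) : ∀ᶠ n in F, ∀ x ∈ K, R n x := by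
  refine hK.induction_on (p := fun s => ∀ᶠ n in F, ∀ x ∈ s, R n x) ?_ ?_ ?_ hR
  · simp
  · intro s t hst ht
    filter_upwards [ht] with n hn x hx using hn x (hst hx)
  · intro s t hs ht
    filter_upwards [hs, ht] with n h1 h2 x hx
    exact hx.elim (h1 x) (h2 x)

theorem exists_mem_eventually_of_prod {X ι : Type*} {F : Filter ι} {G : Filter X}
    {R : ι → X → Prop} (h : ∀ᶠ z in F ×ˢ G, R z.1 z.2) :
    ∃ t ∈ G, ∀ᶠ n in F, ∀ x ∈ t, R n x := by
  obtain ⟨pa, ha, pb, hb, hab⟩ := eventually_prod_iff.1 h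
  exact ⟨_, hb, ha.mono fun n hn x hx => hab hn hx⟩

theorem hausdorffDistance_le {d : ℕ} {M A C : Set (EuclideanSpace ℝ (Fin d))} {ε : ℝ≥0∞}
    (h1 : ∀ a ∈ A, ∃ c ∈ C, geodesicDist M a c ≤ ε)
    (h2 : ∀ c ∈ C, ∃ a ∈ A, geodesicDist M c a ≤ ε) : hausdorffDistance M A C ≤ ε := by
  refine max_le (iSup₂_le fun a ha => ?_) (iSup₂_le fun c hc => ?_)
  · obtain ⟨c, hc, hac⟩ := h1 a ha
    exact (iInf₂_le c hc).trans hac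
  · obtain ⟨a, ha, hca⟩ := h2 c hc
    exact (iInf₂_le a ha).trans hca

section Boundary

variable {d : ℕ} {M : Set (EuclideanSpace ℝ (Fin d))} {φ : EuclideanSpace ℝ (Fin d) → ℝ} {l : ℝ}

theorem preimage_levelSet :
    (Subtype.val : M → EuclideanSpace ℝ (Fin d)) ⁻¹' levelSet M φ l = {x : M | l ≤ φ x} := by
  ext x
  exact ⟨fun h => h.2, fun h => ⟨x.2, h⟩⟩

theorem eq_of_mem_boundaryIn_levelSet (hφ : ContinuousOn φ M) {x : EuclideanSpace ℝ (Fin d)}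
    (hx : x ∈ boundaryIn M (levelSet M φ l)) : x ∈ M ∧ φ x = l := by
  obtain ⟨y, hy, rfl⟩ := hx
  rw [preimage_levelSet] at hy
  have hc : Continuous fun x : M => φ x := continuousOn_iff_continuous_domRestrict.1 hφ
  exact ⟨y.2, (frontier_le_subset_eq continuous_const hc hy).symm⟩

/-- If `Q` missed the frontier, the interior of the level set and the complement of its closure
would be disjoint open sets that cover `Q` and both meet it. Continuity of φ plays no role. -/
theorem IsPreconnected.exists_mem_boundaryIn_levelSet {Q : Set (EuclideanSpace ℝ (Fin d))}
    (hQ : IsPreconnected Q) (hQM : Q ⊆ M) {a b : EuclideanSpace ℝ (Fin d)} (ha : a ∈ Q)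
    (hb : b ∈ Q) (hφa : l ≤ φ a) (hφb : φ b < l) :
    ∃ c ∈ Q, c ∈ boundaryIn M (levelSet M φ l) := by
  set S := (Subtype.val : M → EuclideanSpace ℝ (Fin d)) ⁻¹' levelSet M φ l with hS
  set Q' := (Subtype.val : M → EuclideanSpace ℝ (Fin d)) ⁻¹' Q with hQ'
  have hQc : IsPreconnected Q' := by
    rw [← IsInducing.subtypeVal.isPreconnected_image, hQ', Subtype.image_preimage_coe,
      inter_eq_right.2 hQM]
    exact hQ
  by_contra! hcon
  have hfr : ∀ y ∈ Q', y ∉ frontier S := fun y hy hyf => hcon y hy ⟨y, hyf, rfl⟩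
  have hin : ∀ y ∈ Q', y ∈ S → y ∈ interior S := fun y hy hyS => by
    by_contra h
    exact hfr y hy ⟨subset_closure hyS, h⟩
  have hout : ∀ y ∈ Q', y ∉ S → y ∈ (closure S)ᶜ := fun y hy hyS h =>
    hfr y hy ⟨h, fun h' => hyS (interior_subset h')⟩
  have haS : (⟨a, hQM ha⟩ : M) ∈ S := ⟨hQM ha, hφa⟩
  have hbS : (⟨b, hQM hb⟩ : M) ∉ S := fun h => absurd h.2 (not_le.2 hφb)
  obtain ⟨y, -, hy1, hy2⟩ := hQc (interior S) (closure S)ᶜ isOpen_interior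
    isClosed_closure.isOpen_compl
    (fun y hy => by
      by_cases h : y ∈ S
      · exact Or.inl (hin y hy h)
      · exact Or.inr (hout y hy h))
    ⟨⟨a, hQM ha⟩, ha, hin _ ha haS⟩ ⟨⟨b, hQM hb⟩, hb, hout _ hb hbS⟩
  exact hy2 (interior_subset_closure hy1)

theorem mem_boundaryIn_levelSet {x : EuclideanSpace ℝ (Fin d)} (hx : x ∈ M) (hφx : φ x = l)
    (hb : ∃ b : ℕ → EuclideanSpace ℝ (Fin d), (∀ n, b n ∈ M ∧ φ (b n) < l) ∧
      Tendsto b atTop (𝓝 x)) : x ∈ boundaryIn M (levelSet M φ l) := by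
  obtain ⟨b, hbM, hbx⟩ := hb
  refine ⟨⟨x, hx⟩, ?_, rfl⟩
  rw [preimage_levelSet]
  refine ⟨subset_closure hφx.ge, fun hint => ?_⟩
  have hlim : Tendsto (fun n => (⟨b n, (hbM n).1⟩ : M)) atTop (𝓝 ⟨x, hx⟩) :=
    tendsto_subtype_rng.2 hbx
  obtain ⟨n, hn⟩ := (hlim.eventually (mem_interior_iff_mem_nhds.1 hint)).exists
  exact absurd (hbM n).2 (not_lt.2 hn)

end Boundary

/-- The functions `φ n` converge to `f`, uniformly on compact subsets of the interior of `M`, and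
from above on all of `M`. -/
structure TendstoAtInterior {d : ℕ} (d' : ℕ) (M : Set (EuclideanSpace ℝ (Fin d)))
    (φ : ℕ → EuclideanSpace ℝ (Fin d) → ℝ) (f : EuclideanSpace ℝ (Fin d) → ℝ) : Prop where
  eventually_lt : ∀ p ∈ M, ∀ c, f p < c → ∃ t ∈ 𝓝[M] p, ∀ᶠ n in atTop, ∀ x ∈ t, φ n x < c
  eventually_gt : ∀ p ∈ M, p ∉ manifoldBoundary d' M → ∀ c, c < f p →
    ∃ t ∈ 𝓝[M] p, ∀ᶠ n in atTop, ∀ x ∈ t, c < φ n x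

section Convergence

variable {d d' : ℕ} {M : Set (EuclideanSpace ℝ (Fin d))}
  {φ : ℕ → EuclideanSpace ℝ (Fin d) → ℝ} {f : EuclideanSpace ℝ (Fin d) → ℝ} {l : ℝ}

theorem eventually_lt_nhds (hf : ContinuousOn f M) {p : EuclideanSpace ℝ (Fin d)} (hp : p ∈ M)
    {c : ℝ} (hc : f p < c) : {x | f x < c} ∈ 𝓝[M] p := (hf p hp).eventually_lt_const hc

theorem eventually_gt_nhds (hf : ContinuousOn f M) {p : EuclideanSpace ℝ (Fin d)} (hp : p ∈ M)
    {c : ℝ} (hc : c < f p) : {x | c < f x} ∈ 𝓝[M] p := (hf p hp).eventually_const_lt hc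

theorem TendstoAtInterior.eventually_apply_gt (hφ : TendstoAtInterior d' M φ f)
    {p : EuclideanSpace ℝ (Fin d)} (hp : p ∈ M) (hpb : p ∉ manifoldBoundary d' M) {c : ℝ}
    (hc : c < f p) : ∀ᶠ n in atTop, c < φ n p := by
  obtain ⟨t, ht, h⟩ := hφ.eventually_gt p hp hpb c hc
  filter_upwards [h] with n hn using hn p (mem_of_mem_nhdsWithin hp ht)

theorem TendstoAtInterior.eventually_apply_lt (hφ : TendstoAtInterior d' M φ f)
    {p : EuclideanSpace ℝ (Fin d)} (hp : p ∈ M) {c : ℝ}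
    (hc : f p < c) : ∀ᶠ n in atTop, φ n p < c := by
  obtain ⟨t, ht, h⟩ := hφ.eventually_lt p hp c hc
  filter_upwards [h] with n hn using hn p (mem_of_mem_nhdsWithin hp ht)

theorem exists_mem_gt_of_mem_nhds
    (hreg : ∀ x ∈ M, f x = l → ∃ a : ℕ → EuclideanSpace ℝ (Fin d),
        (∀ n, a n ∈ M ∧ l < f (a n)) ∧ Tendsto a atTop (𝓝 x))
    {p : EuclideanSpace ℝ (Fin d)} (hp : p ∈ M) (hpl : l ≤ f p)
    {Q : Set (EuclideanSpace ℝ (Fin d))} (hQ : Q ∈ 𝓝[M] p) : ∃ a ∈ Q, a ∈ M ∧ l < f a := by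
  rcases hpl.eq_or_lt with h | h
  · obtain ⟨a, haM, hap⟩ := hreg p hp h.symm
    have : Tendsto a atTop (𝓝[M] p) :=
      tendsto_nhdsWithin_iff.2 ⟨hap, Eventually.of_forall fun n => (haM n).1⟩
    obtain ⟨n, hn⟩ := (this.eventually hQ).exists
    exact ⟨a n, hn, haM n⟩
  · exact ⟨p, mem_of_mem_nhdsWithin hp hQ, hp, h⟩

theorem exists_mem_lt_of_mem_nhds
    (hreg : ∀ x ∈ M, f x = l → ∃ b : ℕ → EuclideanSpace ℝ (Fin d),
        (∀ n, b n ∈ M ∧ f (b n) < l) ∧ Tendsto b atTop (𝓝 x))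
    {p : EuclideanSpace ℝ (Fin d)} (hp : p ∈ M) (hpl : f p = l)
    {Q : Set (EuclideanSpace ℝ (Fin d))} (hQ : Q ∈ 𝓝[M] p) : ∃ b ∈ Q, b ∈ M ∧ f b < l := by
  obtain ⟨b, hbM, hbp⟩ := hreg p hp hpl
  have : Tendsto b atTop (𝓝[M] p) :=
    tendsto_nhdsWithin_iff.2 ⟨hbp, Eventually.of_forall fun n => (hbM n).1⟩
  obtain ⟨n, hn⟩ := (this.eventually hQ).exists
  exact ⟨b n, hn, hbM n⟩

theorem exists_ofReal_le {ε : ℝ≥0∞} (hε : 0 < ε) : ∃ η : ℝ, 0 < η ∧ ENNReal.ofReal η ≤ ε := by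
  obtain ⟨r, hr0, hr⟩ := ENNReal.lt_iff_exists_nnreal_btwn.1 hε
  exact ⟨r, by exact_mod_cast hr0, by simpa using hr.le⟩

/-- Near p with f p < l neither set has points eventually. Near p with f p ≥ l, p itself is close to
every point of the estimated set. Conversely, p may drop out of that set when f p = l, so a nearby
point with f > l replaces it. -/
theorem TendstoAtInterior.tendsto_hausdorffDistance_levelSet (hM : IsC2Submanifold d' M)
    (hMc : IsCompact M) (hf : ContinuousOn f M) (hφ : TendstoAtInterior d' M φ f)
    (hreg : ∀ x ∈ M, f x = l → ∃ a : ℕ → EuclideanSpace ℝ (Fin d),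
        (∀ n, a n ∈ M ∧ l < f (a n)) ∧ Tendsto a atTop (𝓝 x))
    (hbd : ∀ x ∈ M, l ≤ f x → x ∉ manifoldBoundary d' M) :
    Tendsto (fun n => hausdorffDistance M (levelSet M (φ n) l) (levelSet M f l)) atTop (𝓝 0) := by
  refine ENNReal.tendsto_nhds_zero.2 fun ε hε => ?_
  obtain ⟨η, hη, hηε⟩ := exists_ofReal_le hε
  have h1 : ∀ᶠ n in atTop, ∀ x ∈ M, l ≤ φ n x →
      ∃ c ∈ levelSet M f l, geodesicDist M x c ≤ ENNReal.ofReal η := by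
    refine hMc.eventually_forall_of_nhdsWithin fun p hp => ?_
    rcases lt_or_ge (f p) l with hpl | hpl
    · obtain ⟨t, ht, htn⟩ := hφ.eventually_lt p hp l hpl
      refine ⟨t, ht, htn.mono fun n hn x hx hxl => absurd (hn x hx) (not_lt.2 hxl)⟩
    · obtain ⟨Q, hQ, -, -, hQd⟩ := hM.exists_preconnected_nhds hp hη
      exact ⟨Q, hQ, Eventually.of_forall fun n x hx _ =>
        ⟨p, ⟨hp, hpl⟩, hQd x hx p (mem_of_mem_nhdsWithin hp hQ)⟩⟩
  have h2 : ∀ᶠ n in atTop, ∀ x ∈ M, l ≤ f x →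
      ∃ a ∈ levelSet M (φ n) l, geodesicDist M x a ≤ ENNReal.ofReal η := by
    refine hMc.eventually_forall_of_nhdsWithin fun p hp => ?_
    rcases lt_or_ge (f p) l with hpl | hpl
    · exact ⟨_, eventually_lt_nhds hf hp hpl, Eventually.of_forall fun n x hx hxl =>
        absurd hx (not_lt.2 hxl)⟩
    · obtain ⟨Q, hQ, -, -, hQd⟩ := hM.exists_preconnected_nhds hp hη
      obtain ⟨a, haQ, haM, hal⟩ := exists_mem_gt_of_mem_nhds hreg hp hpl hQ
      refine ⟨Q, hQ, (hφ.eventually_apply_gt haM (hbd a haM hal.le) hal).mono fun n hn x hx _ =>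
        ⟨a, ⟨haM, hn.le⟩, hQd x hx a haQ⟩⟩
  filter_upwards [h1, h2] with n hn1 hn2
  exact (hausdorffDistance_le (fun a ha => hn1 a ha.1 ha.2) fun c hc => hn2 c hc.1 hc.2).trans hηε

/-- Both boundaries lie in level surfaces, so only points p with f p = l matter in the limit. Such a
p is itself in the boundary for f, and a connected neighbourhood containing points on either side of
l contains a boundary point for φ n. -/
theorem TendstoAtInterior.tendsto_hausdorffDistance_boundaryIn (hM : IsC2Submanifold d' M)
    (hMc : IsCompact M) (hf : ContinuousOn f M) (hφc : ∀ n, ContinuousOn (φ n) M)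
    (hφ : TendstoAtInterior d' M φ f)
    (hrega : ∀ x ∈ M, f x = l → ∃ a : ℕ → EuclideanSpace ℝ (Fin d),
        (∀ n, a n ∈ M ∧ l < f (a n)) ∧ Tendsto a atTop (𝓝 x))
    (hregb : ∀ x ∈ M, f x = l → ∃ b : ℕ → EuclideanSpace ℝ (Fin d),
        (∀ n, b n ∈ M ∧ f (b n) < l) ∧ Tendsto b atTop (𝓝 x))
    (hbd : ∀ x ∈ M, l ≤ f x → x ∉ manifoldBoundary d' M) :
    Tendsto (fun n => hausdorffDistance M (boundaryIn M (levelSet M (φ n) l))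
      (boundaryIn M (levelSet M f l))) atTop (𝓝 0) := by
  refine ENNReal.tendsto_nhds_zero.2 fun ε hε => ?_
  obtain ⟨η, hη, hηε⟩ := exists_ofReal_le hε
  have h1 : ∀ᶠ n in atTop, ∀ x ∈ M, φ n x = l →
      ∃ c ∈ boundaryIn M (levelSet M f l), geodesicDist M x c ≤ ENNReal.ofReal η := by
    refine hMc.eventually_forall_of_nhdsWithin fun p hp => ?_
    rcases lt_trichotomy (f p) l with hpl | hpl | hpl
    · obtain ⟨t, ht, htn⟩ := hφ.eventually_lt p hp l hpl
      exact ⟨t, ht, htn.mono fun n hn x hx hxl => absurd hxl (hn x hx).ne⟩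
    · obtain ⟨Q, hQ, -, -, hQd⟩ := hM.exists_preconnected_nhds hp hη
      exact ⟨Q, hQ, Eventually.of_forall fun n x hx _ =>
        ⟨p, mem_boundaryIn_levelSet hp hpl (hregb p hp hpl),
          hQd x hx p (mem_of_mem_nhdsWithin hp hQ)⟩⟩
    · obtain ⟨t, ht, htn⟩ := hφ.eventually_gt p hp (hbd p hp hpl.le) l hpl
      exact ⟨t, ht, htn.mono fun n hn x hx hxl => absurd hxl (hn x hx).ne'⟩
  have h2 : ∀ᶠ n in atTop, ∀ x ∈ M, f x = l →
      ∃ a ∈ boundaryIn M (levelSet M (φ n) l), geodesicDist M x a ≤ ENNReal.ofReal η := by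
    refine hMc.eventually_forall_of_nhdsWithin fun p hp => ?_
    rcases lt_trichotomy (f p) l with hpl | hpl | hpl
    · exact ⟨_, eventually_lt_nhds hf hp hpl, Eventually.of_forall fun n x hx hxl =>
        absurd hxl (ne_of_lt hx)⟩
    · obtain ⟨Q, hQ, hQM, hQc, hQd⟩ := hM.exists_preconnected_nhds hp hη
      obtain ⟨a, haQ, haM, hal⟩ := exists_mem_gt_of_mem_nhds hrega hp hpl.ge hQ
      obtain ⟨b, hbQ, hbM, hbl⟩ := exists_mem_lt_of_mem_nhds hregb hp hpl hQ
      refine ⟨Q, hQ, ?_⟩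
      filter_upwards [hφ.eventually_apply_gt haM (hbd a haM hal.le) hal,
        hφ.eventually_apply_lt hbM hbl] with n hna hnb x hx _
      obtain ⟨c, hcQ, hc⟩ :=
        IsPreconnected.exists_mem_boundaryIn_levelSet hQc hQM haQ hbQ hna.le hnb
      exact ⟨c, hc, hQd x hx c hcQ⟩
    · exact ⟨_, eventually_gt_nhds hf hp hpl, Eventually.of_forall fun n x hx hxl =>
        absurd hxl (ne_of_gt hx)⟩
  filter_upwards [h1, h2] with n hn1 hn2
  refine (hausdorffDistance_le (fun a ha => ?_) fun c hc => ?_).trans hηε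
  · obtain ⟨haM, hal⟩ := eq_of_mem_boundaryIn_levelSet (hφc n) ha
    exact hn1 a haM hal
  · obtain ⟨hcM, hcl⟩ := eq_of_mem_boundaryIn_levelSet hf hc
    exact hn2 c hcM hcl

/-- For large n the symmetric difference lies in the shell |f - l| < δ; these shells decrease to {f
= l}, which is null. -/
theorem TendstoAtInterior.tendsto_measureDistance (hMc : IsCompact M) (hf : ContinuousOn f M)
    (hφ : TendstoAtInterior d' M φ f) (hbd : ∀ x ∈ M, l ≤ f x → x ∉ manifoldBoundary d' M)
    (μ : Measure (EuclideanSpace ℝ (Fin d))) [IsFiniteMeasure μ]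
    (hμ : μ {x | x ∈ M ∧ f x = l} = 0) :
    Tendsto (fun n => measureDistance μ (levelSet M (φ n) l) (levelSet M f l)) atTop (𝓝 0) := by
  set S : ℕ → Set (EuclideanSpace ℝ (Fin d)) :=
    fun j => {x | x ∈ M ∧ |f x - l| < 1 / (j + 1 : ℝ)} with hS
  have hSm : ∀ j, NullMeasurableSet (S j) μ := fun j => by
    have hc : ContinuousOn (fun x => |f x - l|) M := (hf.sub continuousOn_const).abs
    obtain ⟨u, hu, huM⟩ := continuousOn_iff'.1 hc (Iio (1 / (j + 1 : ℝ))) isOpen_Iio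
    have : S j = u ∩ M := by
      rw [← huM]
      ext x
      exact and_comm
    rw [this]
    exact (hu.measurableSet.inter hMc.measurableSet).nullMeasurableSet
  have hSa : Antitone S := fun i j hij x hx => ⟨hx.1, hx.2.trans_le (by gcongr)⟩
  have hSi : ⋂ j, S j = {x | x ∈ M ∧ f x = l} := by
    ext x
    simp only [mem_iInter, hS, mem_ofPred_eq]
    constructor
    · intro h
      refine ⟨(h 0).1, ?_⟩
      by_contra hne
      obtain ⟨j, hj⟩ := exists_nat_one_div_lt (abs_pos.2 (sub_ne_zero.2 hne))
      exact absurd (h j).2 (not_lt.2 hj.le)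
    · rintro ⟨h1, h2⟩ j
      refine ⟨h1, ?_⟩
      rw [h2, sub_self, abs_zero]
      positivity
  have hlim : Tendsto (fun j => μ (S j)) atTop (𝓝 0) := by
    have := tendsto_measure_iInter_atTop (μ := μ) hSm hSa ⟨0, measure_ne_top _ _⟩
    rwa [hSi, hμ] at this
  refine ENNReal.tendsto_nhds_zero.2 fun ε hε => ?_
  obtain ⟨j, hj⟩ := (hlim.eventually (Iic_mem_nhds (ENNReal.half_pos hε.ne'))).exists
  set δ : ℝ := 1 / (j + 1 : ℝ) with hδ
  have hδ0 : 0 < δ := by positivity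
  have key : ∀ᶠ n in atTop, ∀ x ∈ M, (l ≤ φ n x → l - δ < f x) ∧ (φ n x < l → f x < l + δ) := by
    refine hMc.eventually_forall_of_nhdsWithin fun p hp => ?_
    -- When f p < l, the point may lie on ∂M, and the upper bound on φ n alone settles both
    -- implications. The lower bound is used only where f p ≥ l + δ.
    rcases lt_or_ge (f p) l with hpl | hpl
    · obtain ⟨t, ht, htn⟩ := hφ.eventually_lt p hp l hpl
      refine ⟨t ∩ {x | f x < l}, inter_mem ht (eventually_lt_nhds hf hp hpl),
        htn.mono fun n hn x hx => ⟨fun h => absurd (hn x hx.1) (not_lt.2 h), fun _ => ?_⟩⟩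
      have : f x < l := hx.2
      linarith
    · have h1 := eventually_gt_nhds hf hp (by linarith : l - δ < f p)
      rcases lt_or_ge (f p) (l + δ) with hpl' | hpl'
      · exact ⟨_, inter_mem h1 (eventually_lt_nhds hf hp hpl'),
          Eventually.of_forall fun n x hx => ⟨fun _ => hx.1, fun _ => hx.2⟩⟩
      · obtain ⟨t, ht, htn⟩ := hφ.eventually_gt p hp (hbd p hp hpl) l (by linarith)
        exact ⟨_, inter_mem h1 ht, htn.mono fun n hn x hx =>
          ⟨fun _ => hx.1, fun h => absurd (hn x hx.2) (not_lt.2 h.le)⟩⟩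
  filter_upwards [key] with n hn
  have h1 : levelSet M (φ n) l \ levelSet M f l ⊆ S j := by
    rintro x ⟨⟨hxM, hx⟩, hx2⟩
    have h3 : f x < l := not_le.1 fun h => hx2 ⟨hxM, h⟩
    refine ⟨hxM, abs_lt.2 ⟨?_, ?_⟩⟩
    · linarith [(hn x hxM).1 hx]
    · linarith
  have h2 : levelSet M f l \ levelSet M (φ n) l ⊆ S j := by
    rintro x ⟨⟨hxM, hx⟩, hx2⟩
    have h3 : φ n x < l := not_le.1 fun h => hx2 ⟨hxM, h⟩
    refine ⟨hxM, abs_lt.2 ⟨?_, ?_⟩⟩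
    · linarith
    · linarith [(hn x hxM).2 h3]
  calc _ ≤ ε / 2 + ε / 2 := add_le_add ((measure_mono h1).trans hj) ((measure_mono h2).trans hj)
    _ = ε := ENNReal.add_halves ε

end Convergence

/-! ### Level sets with nonzero gradient are null -/

/-- A set on which a function is constant, and has nonzero derivatives, is a null set. -/
theorem volume_eq_zero_of_hasFDerivAt_ne_zero {k : ℕ} {F : EuclideanSpace ℝ (Fin k) → ℝ} {l : ℝ}
    {T : Set (EuclideanSpace ℝ (Fin k))} (hT : ∀ u ∈ T, F u = l)
    (hF : ∀ u ∈ T, ∃ D : EuclideanSpace ℝ (Fin k) →L[ℝ] ℝ, HasFDerivAt F D u ∧ D ≠ 0) :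
    volume T = 0 := by
  have hA : ∀ u, ∃ A : EuclideanSpace ℝ (Fin k) →L[ℝ] EuclideanSpace ℝ (Fin k),
      u ∈ T → HasFDerivWithinAt id A T u ∧ A.det = 0 := by
    intro u
    by_cases hu : u ∈ T
    swap
    · exact ⟨0, fun h => absurd h hu⟩
    obtain ⟨D, hD, hD0⟩ := hF u hu
    obtain ⟨z₀, hz₀⟩ : ∃ z, D z ≠ 0 := by
      by_contra! h
      exact hD0 (ContinuousLinearMap.ext h)
    set z := (D z₀)⁻¹ • z₀ with hz
    have hDz : D z = 1 := by simp [hz, hz₀]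
    -- On T the identity coincides with w ↦ w - (F w - l) z, whose derivative kills z because D z =
    -- 1. So within T the identity has a singular derivative, and its image, T itself, is null.
    refine ⟨ContinuousLinearMap.id ℝ _ - D.smulRight z, fun _ => ⟨?_, ?_⟩⟩
    · have h1 : HasFDerivAt (fun w => w - (F w - l) • z)
          (ContinuousLinearMap.id ℝ _ - D.smulRight z) u :=
        (hasFDerivAt_id u).sub ((hD.sub_const l).smul_const z)
      refine h1.hasFDerivWithinAt.congr (fun w hw => ?_) ?_
      · simp [hT w hw]
      · simp [hT u hu]
    · by_contra hdet
      set A := ContinuousLinearMap.id ℝ (EuclideanSpace ℝ (Fin k)) - D.smulRight z with hAdef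
      have hinj : Function.Injective A := by
        have := (LinearMap.isUnit_iff_isUnit_det A.toLinearMap).2 (isUnit_iff_ne_zero.2 hdet)
        exact ((Module.End.isUnit_iff _).1 this).1
      have hAz : A z = 0 := by simp [hAdef, hDz]
      have : z = 0 := hinj (by rw [hAz, map_zero])
      rw [this, map_zero] at hDz
      exact zero_ne_one hDz
  choose A hA using hA
  have := addHaar_image_eq_zero_of_det_fderivWithin_eq_zero (μ := volume) (f := id) (s := T)
    (f' := A) (fun u hu => (hA u hu).1) fun u hu => (hA u hu).2
  simpa using this

/-- A function on `M` whose Riemannian gradient does not vanish has a nonzero derivative in local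
coordinates. -/
theorem IsLocalParametrization.fderiv_ne_zero {d d' : ℕ} {M : Set (EuclideanSpace ℝ (Fin d))}
    {p : EuclideanSpace ℝ (Fin d)} {ε : ℝ}
    {ψ : EuclideanSpace ℝ (Fin d') → EuclideanSpace ℝ (Fin d)} {r : ℝ}
    (hψ : IsLocalParametrization M p ε ψ r univ) (hε : ε < 1) {f : EuclideanSpace ℝ (Fin d) → ℝ}
    {u : EuclideanSpace ℝ (Fin d')} (hu : u ∈ ball 0 r)
    (hsurj : ∀ᶠ y in 𝓝[M] (ψ u), ∃ w ∈ ball 0 r ∩ univ, ψ w = y)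
    {v : EuclideanSpace ℝ (Fin d)} (hv : IsRiemannianGradient M f (ψ u) v) (hv0 : v ≠ 0) :
    ∃ D : EuclideanSpace ℝ (Fin d') →L[ℝ] ℝ, HasFDerivAt (fun w => f (ψ w)) D u ∧ D ≠ 0 := by
  have hb : ball (0 : EuclideanSpace ℝ (Fin d')) r ∈ 𝓝 u := isOpen_ball.mem_nhds hu
  have hψd : HasFDerivAt ψ (fderiv ℝ ψ u) u :=
    ((hψ.contDiffOn.differentiableOn (by norm_num)).differentiableAt hb).hasFDerivAt
  have hfd : HasFDerivWithinAt f (InnerProductSpace.toDual ℝ _ v) M (ψ u) := hv.2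
  have hcomp : HasFDerivAt (fun w => f (ψ w))
      ((InnerProductSpace.toDual ℝ _ v : EuclideanSpace ℝ (Fin d) →L[ℝ] ℝ).comp (fderiv ℝ ψ u)) u :=
    (hfd.comp u hψd.hasFDerivWithinAt fun w hw => hψ.map_mem w ⟨hw, mem_univ w⟩).hasFDerivAt hb
  refine ⟨_, hcomp, fun hD0 => hv0 ?_⟩
  rw [hD0] at hcomp
  have hε' : 0 < 1 - ε := by linarith
  -- If the derivative in coordinates vanished, the lower Lipschitz bound of the chart would carry
  -- this over to f on `M`. Two derivatives within `M` agree on the tangent cone, so v would be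
  -- orthogonal to the tangent space that contains it.
  have hzero : HasFDerivWithinAt f (0 : EuclideanSpace ℝ (Fin d) →L[ℝ] ℝ) M (ψ u) := by
    rw [hasFDerivWithinAt_iff_isLittleO, Asymptotics.isLittleO_iff]
    intro c hc
    have hlo := (hasFDerivAt_iff_isLittleO.1 hcomp).def (c := c * (1 - ε)) (by positivity)
    obtain ⟨δ, hδ, hδb⟩ := Metric.mem_nhds_iff.1 hlo
    have hnear : ∀ᶠ y in 𝓝[M] (ψ u), dist y (ψ u) < (1 - ε) * δ :=
      mem_nhdsWithin_of_mem_nhds (ball_mem_nhds _ (by positivity))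
    filter_upwards [hsurj, hnear] with y ⟨w, hw, hwy⟩ hy
    have hl := hψ.lower w hw.1 u hu
    rw [hwy] at hl
    have hwδ : w ∈ ball u δ := by
      rw [mem_ball, dist_eq_norm]
      rw [dist_eq_norm] at hy
      exact lt_of_mul_lt_mul_left (hl.trans_lt hy) hε'.le
    have h1 := hδb hwδ
    simp only [mem_ofPred_eq, zero_apply, sub_zero, hwy] at h1 ⊢
    calc _ ≤ _ := h1
      _ = c * ((1 - ε) * ‖w - u‖) := by ring
      _ ≤ c * ‖y - ψ u‖ := by gcongr
  have heq := hfd.unique_on hzero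
  have hspan : ∀ t ∈ tangentSpace M (ψ u), inner ℝ v t = 0 := by
    intro t ht
    have hle : tangentSpace M (ψ u) ≤ LinearMap.ker
        (InnerProductSpace.toDual ℝ _ v : EuclideanSpace ℝ (Fin d) →L[ℝ] ℝ).toLinearMap := by
      refine Submodule.span_le.2 fun s hs => ?_
      exact heq hs
    exact hle ht
  exact inner_self_eq_zero.1 (hspan v hv.1)

/-- Nullity is local, and the chart sends null sets to null sets, so the claim reduces to a level
set with nonzero derivative in ℝ^d'. -/
theorem volumeMeasure_eq_zero_of_gradient_ne_zero {d d' : ℕ} {M : Set (EuclideanSpace ℝ (Fin d))}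
    (hM : IsC2Submanifold d' M) {f : EuclideanSpace ℝ (Fin d) → ℝ} {l : ℝ}
    (hbd : ∀ x ∈ M, f x = l → x ∉ manifoldBoundary d' M)
    (hgrad : ∀ x ∈ M, f x = l → ∃ v, IsRiemannianGradient M f x v ∧ v ≠ 0) :
    volumeMeasure d' M {x | x ∈ M ∧ f x = l} = 0 := by
  refine le_antisymm ((Measure.restrict_apply_le _ _).trans (le_of_eq ?_)) zero_le
  refine measure_null_of_locally_null _ fun p hp => ?_
  obtain ⟨ψ, r, hψ, -⟩ := hM.exists_localParametrization_univ hp.1 (hbd p hp.1 hp.2)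
    (ε := 1 / 2) (by norm_num) (univ_mem (f := 𝓝 p))
  -- The chart is assumed to cover a neighbourhood in `M` of p only. The last condition asks the
  -- same at ψ u, and it holds for all points of `M` close to p.
  set T : Set (EuclideanSpace ℝ (Fin d')) := {u | u ∈ ball 0 r ∧ f (ψ u) = l ∧
    ∀ᶠ y in 𝓝[M] (ψ u), ∃ w ∈ ball 0 r ∩ univ, ψ w = y} with hT
  have hT0 : volume T = 0 := by
    refine volume_eq_zero_of_hasFDerivAt_ne_zero (F := fun u => f (ψ u)) (l := l)
      (fun u hu => hu.2.1) fun u hu => ?_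
    obtain ⟨v, hv, hv0⟩ := hgrad (ψ u) (hψ.map_mem u ⟨hu.1, mem_univ u⟩) hu.2.1
    exact hψ.fderiv_ne_zero (by norm_num) hu.1 hu.2.2 hv hv0
  refine ⟨ψ '' T, ?_, ?_⟩
  · have hle : 𝓝[{x | x ∈ M ∧ f x = l}] p ≤ 𝓝[M] p := nhdsWithin_mono p fun x hx => hx.1
    filter_upwards [hle (eventually_eventually_nhdsWithin.2 hψ.surj), hle hψ.surj,
      self_mem_nhdsWithin] with x hx1 ⟨u, hu, hux⟩ hx3
    subst hux
    exact ⟨u, ⟨hu.1, hx3.2, hx1⟩, rfl⟩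
  · have := hψ.measure_image_le (by norm_num) (A := T) fun u hu => hu.1
    rw [hT0, mul_zero] at this
    exact le_antisymm this zero_le

/-! ### Application to the kernel density estimator -/

theorem continuous_kde {d : ℕ} (k : ℕ) (h : ℝ) (n : ℕ) (X : ℕ → EuclideanSpace ℝ (Fin d)) :
    Continuous (kde k h n X) := by
  unfold kde
  refine continuous_const.mul (continuous_finsetSum _ fun i _ => ?_)
  exact (continuous_gaussKernel k).comp (by fun_prop)

theorem tendstoAtInterior_kde {d d' : ℕ} {M : Set (EuclideanSpace ℝ (Fin d))}
    (hM : IsC2Submanifold d' M) (hMm : MeasurableSet M) {f : EuclideanSpace ℝ (Fin d) → ℝ}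
    (hf : IsDensity d' M f) (hfc : ContinuousOn f M) {h : ℕ → ℝ} (hpos : ∀ n, 0 < h n)
    (hh : Tendsto h atTop (𝓝 0)) {X : ℕ → EuclideanSpace ℝ (Fin d)}
    (hdev : ∀ η > 0, ∀ᶠ n in atTop, ∀ x ∈ M, |kde d' (h n) n X x -
      meanKernel d' (densityMeasure d' M f) (h n) x / h n ^ d'| < η) :
    TendstoAtInterior d' M (fun n => kde d' (h n) n X) f := by
  have hlim : ∀ p, Tendsto (Prod.map h id) (atTop ×ˢ 𝓝[M] p) (𝓝[>] 0 ×ˢ 𝓝[M] p) := fun p =>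
    (tendsto_nhdsWithin_iff.2 ⟨hh, Eventually.of_forall hpos⟩).prodMap tendsto_id
  constructor
  · intro p hp c hc
    obtain ⟨c₁, hc₁, hc₁c⟩ := exists_between hc
    obtain ⟨t, ht, htn⟩ := exists_mem_eventually_of_prod (F := atTop)
      (R := fun n x => meanKernel d' (densityMeasure d' M f) (h n) x ≤ c₁ * h n ^ d')
      ((hlim p).eventually (eventually_meanKernel_le hM hf hfc hp hc₁))
    refine ⟨t ∩ M, inter_mem ht self_mem_nhdsWithin, ?_⟩
    filter_upwards [htn, hdev _ (sub_pos.2 hc₁c)] with n hn hnd x hx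
    have h1 := (div_le_iff₀ (pow_pos (hpos n) d')).2 (hn x hx.1)
    linarith [(abs_lt.1 (hnd x hx.2)).2]
  · intro p hp hpb c hc
    obtain ⟨c₁, hc₁, hc₁c⟩ := exists_between hc
    obtain ⟨t, ht, htn⟩ := exists_mem_eventually_of_prod (F := atTop)
      (R := fun n x => c₁ * h n ^ d' ≤ meanKernel d' (densityMeasure d' M f) (h n) x)
      ((hlim p).eventually (eventually_le_meanKernel hM hMm hf hfc hp hpb hc₁c))
    refine ⟨t ∩ M, inter_mem ht self_mem_nhdsWithin, ?_⟩
    filter_upwards [htn, hdev _ (sub_pos.2 hc₁)] with n hn hnd x hx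
    have h1 := (le_div_iff₀ (pow_pos (hpos n) d')).2 (hn x hx.1)
    linarith [(abs_lt.1 (hnd x hx.2)).1]

/-- This is the smallness of the mean that the Chernoff bound exploits; f is bounded on the compact
`M`. -/
theorem exists_eventually_meanKernel_le {d d' : ℕ} {M : Set (EuclideanSpace ℝ (Fin d))}
    (hM : IsC2Submanifold d' M) (hMc : IsCompact M) {f : EuclideanSpace ℝ (Fin d) → ℝ}
    (hf : IsDensity d' M f) (hfc : ContinuousOn f M) {h : ℕ → ℝ} (hpos : ∀ n, 0 < h n)
    (hh : Tendsto h atTop (𝓝 0)) :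
    ∃ C : ℝ, ∀ᶠ n in atTop, ∀ x ∈ M,
      meanKernel d' (densityMeasure d' M f) (h n) x ≤ C * h n ^ d' := by
  obtain ⟨C, hC⟩ := (hMc.image_of_continuousOn hfc).bddAbove
  refine ⟨C + 1, hMc.eventually_forall_of_nhdsWithin fun p hp => ?_⟩
  have hpC : f p < C + 1 := by
    have := hC (mem_image_of_mem f hp)
    linarith
  have hlim : Tendsto (Prod.map h id) (atTop ×ˢ 𝓝[M] p) (𝓝[>] 0 ×ˢ 𝓝[M] p) :=
    (tendsto_nhdsWithin_iff.2 ⟨hh, Eventually.of_forall hpos⟩).prodMap tendsto_id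
  exact exists_mem_eventually_of_prod (F := atTop)
    (R := fun n x => meanKernel d' (densityMeasure d' M f) (h n) x ≤ (C + 1) * h n ^ d')
    (hlim.eventually (eventually_meanKernel_le hM hf hfc hp hpC))

theorem eventually_mul_log_le {h β : ℕ → ℝ} {k : ℕ} (hβ : Tendsto β atTop atTop)
    (hnh : Tendsto (fun n : ℕ => n * h n ^ k / (β n ^ 2 * Real.log n)) atTop atTop) (A : ℝ) :
    ∀ᶠ n : ℕ in atTop, A * Real.log n ≤ n * h n ^ k := by
  filter_upwards [hβ.eventually_ge_atTop 1, hnh.eventually_ge_atTop (max A 0),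
    eventually_ge_atTop 2] with n hβn hn hn2
  have hlog : 0 < Real.log n := Real.log_pos (by exact_mod_cast hn2)
  have hβ2 : 1 ≤ β n ^ 2 := one_le_pow₀ hβn
  rw [le_div_iff₀ (by positivity)] at hn
  refine le_trans ?_ hn
  calc A * Real.log n ≤ max A 0 * (1 * Real.log n) := by
        rw [one_mul]
        gcongr
        exact le_max_left _ _
    _ ≤ max A 0 * (β n ^ 2 * Real.log n) := by gcongr

/-- On a manifold of dimension `0` every set is open and closed. -/
theorem boundaryIn_eq_empty_of_dim_zero {d : ℕ} {M : Set (EuclideanSpace ℝ (Fin d))}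
    (hM : IsC2Submanifold 0 M) (A : Set (EuclideanSpace ℝ (Fin d))) : boundaryIn M A = ∅ := by
  have hdisc : DiscreteTopology M := by
    refine discreteTopology_subtype_iff'.2 fun p hp => ?_
    obtain ⟨ψ, r, H, hψ, -⟩ := hM.exists_localParametrization hp one_pos (univ_mem (f := 𝓝 p))
    obtain ⟨U, hU, hUo, hpU⟩ := _root_.eventually_nhds_iff.1 (eventually_nhdsWithin_iff.1 hψ.surj)
    refine ⟨U, hUo, ?_⟩
    ext x
    constructor
    · rintro ⟨hxU, hxM⟩
      obtain ⟨u, -, rfl⟩ := hU x hxU hxM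
      rw [Subsingleton.elim u 0, hψ.map_zero]
      rfl
    · rintro rfl
      exact ⟨hpU, hp⟩
  rw [boundaryIn, (isClopen_discrete _).frontier_eq, image_empty]

end LevelSets

end

theorem theorem3 {d d' : ℕ} (M : Set (EuclideanSpace ℝ (Fin d)))
    (hM : LevelSets.IsC2Submanifold d' M) (hMc : IsCompact M)
    (f : EuclideanSpace ℝ (Fin d) → ℝ)
    (hf : LevelSets.IsDensity d' M f) (hf2 : ContDiffOn ℝ 2 f M)
    {Ω : Type*} [MeasurableSpace Ω] (P : Measure Ω) [IsProbabilityMeasure P]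
    (X : ℕ → Ω → EuclideanSpace ℝ (Fin d))
    (hXm : ∀ i, Measurable (X i)) (hXi : iIndepFun X P)
    (hXf : ∀ i, P.map (X i) = LevelSets.densityMeasure d' M f)
    (hXs : ∀ i, (P.map (X i)).support = M)
    (h β : ℕ → ℝ) (hpos : ∀ n, 0 < h n)
    (hh : Tendsto h atTop (𝓝 0)) (hβ : Tendsto β atTop atTop)
    (hβh : Tendsto (fun n => β n * h n ^ 2) atTop (𝓝 0))
    (hnh : Tendsto (fun n : ℕ => n * h n ^ d' / (β n ^ 2 * Real.log n)) atTop atTop)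
    (l : ℝ) (hl : 0 < l)
    (hreg : ∀ x ∈ M, f x = l →
      (∃ a : ℕ → EuclideanSpace ℝ (Fin d),
        (∀ n, a n ∈ M ∧ l < f (a n)) ∧ Tendsto a atTop (𝓝 x)) ∧
      (∃ b : ℕ → EuclideanSpace ℝ (Fin d),
        (∀ n, b n ∈ M ∧ f (b n) < l) ∧ Tendsto b atTop (𝓝 x)))
    (hne : (LevelSets.boundaryIn M (LevelSets.levelSet M f l)).Nonempty)
    (hbd : LevelSets.levelSet M f l ∩ LevelSets.manifoldBoundary d' M = ∅) :
    ∀ᵐ ω ∂P,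
      Tendsto (fun n => LevelSets.hausdorffDistance M
          (LevelSets.boundaryIn M
            (LevelSets.levelSet M (LevelSets.kde d' (h n) n (fun i => X i ω)) l))
          (LevelSets.boundaryIn M (LevelSets.levelSet M f l))) atTop (𝓝 0) ∧
      Tendsto (fun n => LevelSets.hausdorffDistance M
          (LevelSets.levelSet M (LevelSets.kde d' (h n) n (fun i => X i ω)) l)
          (LevelSets.levelSet M f l)) atTop (𝓝 0) ∧
      ((∀ x ∈ M, f x = l → ∃ v, LevelSets.IsRiemannianGradient M f x v ∧ v ≠ 0) →
        ∀ g : EuclideanSpace ℝ (Fin d) → ℝ, LevelSets.IsDensity d' M g →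
          Tendsto (fun n => LevelSets.measureDistance (LevelSets.densityMeasure d' M g)
            (LevelSets.levelSet M (LevelSets.kde d' (h n) n (fun i => X i ω)) l)
            (LevelSets.levelSet M f l)) atTop (𝓝 0)) := by
  have hfc : ContinuousOn f M := hf2.continuousOn
  -- In dimension 0 the space `M` is discrete and no set has a boundary. Positive dimension is what
  -- gives h^d' ≤ h in the net argument.
  have hd' : d' ≠ 0 := by
    rintro rfl
    rw [LevelSets.boundaryIn_eq_empty_of_dim_zero hM] at hne
    exact Set.not_nonempty_empty hne
  have hbd' : ∀ x ∈ M, l ≤ f x → x ∉ LevelSets.manifoldBoundary d' M := fun x hx hlx hxb => by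
    have : x ∈ LevelSets.levelSet M f l ∩ LevelSets.manifoldBoundary d' M := ⟨⟨hx, hlx⟩, hxb⟩
    rwa [hbd] at this
  have hprob := hf.isProbabilityMeasure
  obtain ⟨C, hC⟩ := LevelSets.exists_eventually_meanKernel_le hM hMc hf hfc hpos hh
  -- The exceptional null set is fixed here, before `g` is introduced, so it serves all densities at
  -- once.
  filter_upwards [LevelSets.ae_eventually_abs_kde_sub_le hd' hMc.isBounded hXm hXi hXf hpos hh
    (LevelSets.eventually_mul_log_le hβ hnh) hC] with ω hω
  have hconv := LevelSets.tendstoAtInterior_kde hM hMc.measurableSet hf hfc hpos hh hω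
  refine ⟨?_, ?_, fun hgrad g hg => ?_⟩
  · exact hconv.tendsto_hausdorffDistance_boundaryIn hM hMc hfc
      (fun n => (LevelSets.continuous_kde _ _ _ _).continuousOn)
      (fun x hx hxl => (hreg x hx hxl).1) (fun x hx hxl => (hreg x hx hxl).2) hbd'
  · exact hconv.tendsto_hausdorffDistance_levelSet hM hMc hfc
      (fun x hx hxl => (hreg x hx hxl).1) hbd'
  · have hgprob := hg.isProbabilityMeasure
    refine hconv.tendsto_measureDistance hMc hfc hbd' (LevelSets.densityMeasure d' M g) ?_
    exact withDensity_absolutelyContinuous _ _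
      (LevelSets.volumeMeasure_eq_zero_of_gradient_ne_zero hM
        (fun x hx hxl => hbd' x hx hxl.ge) hgrad)
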